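/- Let $\mathbb{F}_q$ be a finite field with $q=p^m$ elements, $p$ prime, and let $E/\mathbb{F}_q$ be an ordinary elliptic curve, that is, an elliptic curve having a nonzero $p$-torsion point over an algebraic closure of $\mathbb{F}_q$. For $n\ge 1$ let $N_{q^n}(E)=\#E(\mathbb{F}_{q^n})$ be the number of points of $E$ defined over the extension $\mathbb{F}_{q^n}$ of degree $n$ of $\mathbb{F}_q$, and put $$\overline a_{q^n}:=\frac{q^n+1-N_{q^n}(E)}{q^{n/2}}.$$ Then $\overline a_{q^n}\in[-2,2]$ for every $n\ge 1$, and the sequence $\{\overline a_{q^n}\}_{n\ge 1}$ is equidistributed on $[-2,2]$ with respect to the probability measure $$\frac{1}{\pi}\,\frac{dz}{\sqrt{4-z^2}},$$ where $dz$ is the restriction of the Lebesgue measure to $[-2,2]$; that is, this measure has total mass $1$ and, for every continuous function $f\colon[-2,2]\to\mathbb{C}$, $$\lim_{n\to\infty}\frac1n\sum_{i=1}^n f(\overline a_{q^i})=\frac1\pi\int_{-2}^{2}\frac{f(z)}{\sqrt{4-z^2}}\,dz .$$ -/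

import Mathlib

open MeasureTheory Filter Topology

/-- An elliptic curve `E` over a field `F` of characteristic `p` is ordinary if it has a nonzero
`p`-torsion point over an algebraic closure of `F` (that is, if it is not supersingular). -/
def WeierstrassCurve.IsOrdinary {F : Type*} [Field F] (E : WeierstrassCurve F)
    (p : ℕ) [Fact p.Prime] [CharP F p] : Prop :=
  letI : DecidableEq (AlgebraicClosure F) := Classical.decEq _
  ∃ P : (E.baseChange (AlgebraicClosure F)).toAffine.Point, P ≠ 0 ∧ p • P = 0

/-- The number `N_{q^n}(E)` of points of `E` defined over the extension of degree `n` of the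
finite field `F` with `q` elements (the point at infinity included). -/
noncomputable def WeierstrassCurve.numPoints {F : Type*} [Field F] [Finite F]
    (E : WeierstrassCurve F) (p : ℕ) [Fact p.Prime] [CharP F p] (n : ℕ) [NeZero n] : ℕ :=
  Nat.card (E.baseChange (FiniteField.Extension F p n)).toAffine.Point

/-- The normalized trace `(q^n + 1 - N_{q^n}(E)) / q^(n/2)`, where `q` is the cardinality of `F`. -/
noncomputable def WeierstrassCurve.normalizedTrace {F : Type*} [Field F] [Finite F]
    (E : WeierstrassCurve F) (p : ℕ) [Fact p.Prime] [CharP F p] (n : ℕ) [NeZero n] : ℝ :=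
  ((Nat.card F : ℝ) ^ n + 1 - (E.numPoints p n : ℝ)) / (Nat.card F : ℝ) ^ ((n : ℝ) / 2)

/-- The sequence `x 0, x 1, x 2, …` of points of a compact space `X` is equidistributed with
respect to the measure `μ`, which is required to be of total mass one. -/
def IsEquidistributed {X : Type*} [TopologicalSpace X] [CompactSpace X] [MeasurableSpace X]
    [BorelSpace X] (x : ℕ → X) (μ : Measure X) : Prop :=
  IsProbabilityMeasure μ ∧
    ∀ f : C(X, ℂ), Tendsto (fun n : ℕ => (1 / (n : ℂ)) * ∑ i ∈ Finset.range n, f (x i)) atTop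
      (𝓝 (∫ z, f z ∂μ))

/-- The measure `(1/π) dz / √(4 - z²)` on `[-2, 2]`, where `dz` is the restriction of the Lebesgue
measure. (The density has the junk value `0` at the two end points, a null set.) -/
noncomputable def traceMeasure : Measure (Set.Icc (-2 : ℝ) 2) :=
  (Measure.comap (Subtype.val : Set.Icc (-2 : ℝ) 2 → ℝ) volume).withDensity
    fun z => ENNReal.ofReal (1 / Real.pi * (1 / Real.sqrt (4 - (z : ℝ) ^ 2)))

/-! Write `a = q + 1 - N_q`. Then `q^n + 1 - N_{q^n} = α^n + β^n` with `α + β = a` and `αβ = q`, and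
Hasse's bound `a² ≤ 4q` turns the normalized trace into `2 cos(nθ)` (`normalizedTrace_eq`). This
lies in `[-2, 2]`. If no nonzero multiple of `θ` lies in `2πℤ`, Weyl's theorem
(`tendsto_average_nsmul`) makes the multiples `nθ` equidistributed modulo `2π`, and `2 cos` carries
Haar measure to `traceMeasure`. Ordinarity excludes `kθ ∈ 2πℤ`: along suitable even indices `2n` the
point count would be `(q^n - 1)²`, which is prime to `p`, whereas a `p`-torsion point is rational
over some finite extension and makes `p` divide the count (`IsOrdinary.exists_dvd_numPoints`).

The formula for `N_{q^n}` comes from counting ideals of the affine coordinate ring. Functions with a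
pole of order at most `m ≥ 1` at infinity form a space of dimension `m`. Every nonzero ideal becomes
principal after multiplication by the ideal of exactly one rational point
(`exists_mul_pointIdeal_eq_span`, `eq_of_span_mul_pointIdeal_eq`), so counting ideals reduces to
counting functions. The generating series is `(1 - aT + qT²) / (1 - qT)`; comparing its logarithmic
derivative with that of the Euler product gives `card_algHom_eq`.

Hasse's bound is obtained by Stepanov's method. Over a field with `r²` elements, `card_twisted_le`
builds a nonzero function of small degree vanishing at all rational points, or at all points on
which Frobenius acts as negation; together these bound the error by `3r`. The constant is not sharp,
but letting the degree of the extension grow forces `a² ≤ 4q` (`sq_le_of_eventually_traceSeq_le`).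
-/

namespace WeierstrassCurve.Affine.CoordinateRing

open Polynomial
open scoped Polynomial.Bivariate

/-! ### Pole orders at infinity and Riemann–Roch spaces -/

section Degree

variable {F : Type*} [Field F] {W : Affine F}

instance finite_polynomial : Module.Finite F[X] W.CoordinateRing :=
  .of_basis (CoordinateRing.basis W)

/-- The pole order at infinity of a function on the affine curve, as the degree of its norm. -/
noncomputable def deg (f : W.CoordinateRing) : ℕ :=
  (Algebra.norm F[X] f).natDegree

lemma norm_ne_zero {f : W.CoordinateRing} (hf : f ≠ 0) : Algebra.norm F[X] f ≠ 0 :=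
  (Algebra.norm_ne_zero_iff).mpr hf

lemma deg_mul {f g : W.CoordinateRing} (hf : f ≠ 0) (hg : g ≠ 0) :
    deg (f * g) = deg f + deg g := by
  rw [deg, map_mul, natDegree_mul (norm_ne_zero hf) (norm_ne_zero hg), deg, deg]

lemma deg_pow (f : W.CoordinateRing) (n : ℕ) : deg (f ^ n) = n * deg f := by
  rw [deg, map_pow, natDegree_pow, deg]

lemma deg_one : deg (1 : W.CoordinateRing) = 0 := by
  simp [deg]

/-- `X` has pole order 2 and `Y` has pole order 3, so the two summands have orders of different
parity and cannot cancel. For `m ≤ 2` the natural number `(m - 1) / 2` is 0, which correctly forces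
`q = 0`. -/
lemma deg_basis_le_iff (p q : F[X]) (m : ℕ) :
    deg (p • (1 : W.CoordinateRing) + q • mk W Y) ≤ m ↔
      p ∈ degreeLT F (m / 2 + 1) ∧ q ∈ degreeLT F ((m - 1) / 2) := by
  rw [deg, natDegree_le_iff_degree_le, degree_norm_smul_basis, max_le_iff, mem_degreeLT,
    mem_degreeLT]
  refine and_congr ?_ ?_
  · rcases eq_or_ne p 0 with rfl | hp
    · simp
    · rw [degree_eq_natDegree hp, two_nsmul]
      norm_cast
      omega
  · rcases eq_or_ne q 0 with rfl | hp
    · simp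
    · rw [degree_eq_natDegree hp, two_nsmul]
      norm_cast
      omega

variable (W) in
/-- The coordinate ring as the module of pairs of polynomials. -/
noncomputable def prodEquiv : (F[X] × F[X]) ≃ₗ[F] W.CoordinateRing :=
  LinearEquiv.ofBijective
    { toFun := fun pq => pq.1 • (1 : W.CoordinateRing) + pq.2 • mk W Y
      map_add' := fun a b => by simp only [Prod.fst_add, Prod.snd_add, add_smul]; abel
      map_smul' := fun c a => by simp [smul_add, smul_assoc] }
    ⟨by
      rw [← LinearMap.ker_eq_bot, LinearMap.ker_eq_bot']
      rintro ⟨p, q⟩ h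
      obtain ⟨hp, hq⟩ := smul_basis_eq_zero h
      exact Prod.ext hp hq,
    fun f => by
      obtain ⟨p, q, h⟩ := exists_smul_basis_eq f
      exact ⟨(p, q), h⟩⟩

lemma prodEquiv_apply (p q : F[X]) :
    prodEquiv W (p, q) = p • (1 : W.CoordinateRing) + q • mk W Y := rfl

variable (W) in
/-- The space of functions with a pole of order at most `m` at infinity. -/
noncomputable def degLE (m : ℕ) : Submodule F W.CoordinateRing :=
  ((degreeLT F (m / 2 + 1)).prod (degreeLT F ((m - 1) / 2))).map (prodEquiv W).toLinearMap

lemma mem_degLE {m : ℕ} {f : W.CoordinateRing} : f ∈ degLE W m ↔ deg f ≤ m := by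
  obtain ⟨⟨p, q⟩, rfl⟩ := (prodEquiv W).surjective f
  rw [degLE, Submodule.mem_map_equiv, LinearEquiv.symm_apply_apply, Submodule.mem_prod,
    prodEquiv_apply, deg_basis_le_iff]

instance finite_degreeLT (n : ℕ) : Module.Finite F (degreeLT F n) :=
  .equiv (degreeLTEquiv F n).symm

lemma finrank_degreeLT (n : ℕ) : Module.finrank F (degreeLT F n) = n := by
  rw [(degreeLTEquiv F n).finrank_eq, Module.finrank_fin_fun]

/-- The space `degLE W m` as a product of spaces of polynomials. -/
noncomputable def degLEEquiv (m : ℕ) :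
    (degreeLT F (m / 2 + 1) × degreeLT F ((m - 1) / 2)) ≃ₗ[F] degLE W m :=
  LinearEquiv.trans
    { toFun := fun a => ⟨(a.1, a.2), a.1.2, a.2.2⟩
      invFun := fun a => (⟨a.1.1, a.2.1⟩, ⟨a.1.2, a.2.2⟩)
      map_add' := fun _ _ => rfl
      map_smul' := fun _ _ => rfl }
    ((prodEquiv W).submoduleMap
      ((degreeLT F (m / 2 + 1)).prod (degreeLT F ((m - 1) / 2))))

instance finite_degLE (m : ℕ) : Module.Finite F (degLE W m) :=
  .equiv (degLEEquiv m)

/-- Riemann–Roch in genus one for multiples of the point at infinity; `m = 0` is excluded because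
the constants give dimension 1. -/
lemma finrank_degLE {m : ℕ} (hm : 1 ≤ m) : Module.finrank F (degLE W m) = m := by
  rw [← (degLEEquiv m).finrank_eq, Module.finrank_prod, finrank_degreeLT, finrank_degreeLT]
  omega

lemma deg_neg (f : W.CoordinateRing) : deg (-f) = deg f :=
  le_antisymm (mem_degLE.mp ((degLE W _).neg_mem (mem_degLE.mpr le_rfl)))
    (by simpa using mem_degLE.mp ((degLE W _).neg_mem (mem_degLE.mpr (le_refl (deg (-f))))))

lemma deg_mul_le (f g : W.CoordinateRing) : deg (f * g) ≤ deg f + deg g := by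
  rw [deg, map_mul]
  exact natDegree_mul_le

lemma deg_zero : deg (0 : W.CoordinateRing) = 0 := by
  rw [deg, Algebra.norm_zero, natDegree_zero]

lemma finrank_quotient_span {f : W.CoordinateRing} (hf : f ≠ 0) :
    Module.finrank F (W.CoordinateRing ⧸ Ideal.span {f}) = deg f :=
  finrank_quotient_span_eq_natDegree_norm (CoordinateRing.basis W) hf

instance finite_quotient_smith {ι : Type*} [Finite ι] {b : Module.Basis ι F[X] W.CoordinateRing}
    {I : Ideal W.CoordinateRing} (hI : I ≠ ⊥) (i : ι) :
    FiniteDimensional F (F[X] ⧸ Ideal.span ({I.smithCoeffs b hI i} : Set F[X])) :=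
  PowerBasis.finite <| AdjoinRoot.powerBasis <| I.smithCoeffs_ne_zero b hI i

lemma finite_quotient {I : Ideal W.CoordinateRing} (hI : I ≠ ⊥) :
    Module.Finite F (W.CoordinateRing ⧸ I) := by
  have e := I.quotientEquivDirectSum F (CoordinateRing.basis W) hI
  exact .equiv e.symm

/-- A nonzero function has at most as many zeros as its pole order. -/
lemma card_algHom_le_deg {K : Type*} [Field K] [Algebra F K] {f : W.CoordinateRing} (hf : f ≠ 0) :
    Finite {χ : W.CoordinateRing →ₐ[F] K // χ f = 0} ∧
      Nat.card {χ : W.CoordinateRing →ₐ[F] K // χ f = 0} ≤ deg f := by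
  have := finite_quotient (F := F) (mt Ideal.span_singleton_eq_bot.mp hf)
  -- Homomorphisms killing `f` factor through a quotient of dimension `deg f`, which has at most
  -- that many homomorphisms to a field.
  let φ : {χ : W.CoordinateRing →ₐ[F] K // χ f = 0} →
      ((W.CoordinateRing ⧸ Ideal.span {f}) →ₐ[F] K) := fun χ =>
    Ideal.Quotient.liftₐ _ χ.1 fun a ha => by
      obtain ⟨b, rfl⟩ := Ideal.mem_span_singleton'.mp ha
      rw [map_mul, χ.2, mul_zero]
  have hφ : Function.Injective φ := fun χ ψ h => by
    ext1
    apply AlgHom.ext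
    intro a
    exact DFunLike.congr_fun h (Ideal.Quotient.mk _ a)
  have : Finite ((W.CoordinateRing ⧸ Ideal.span {f}) →ₐ[F] K) :=
    inferInstance
  refine ⟨Finite.of_injective φ hφ, (Nat.card_le_card_of_injective φ hφ).trans ?_⟩
  rw [← finrank_quotient_span hf]
  exact card_algHom_le_finrank F _ K

end Degree

end WeierstrassCurve.Affine.CoordinateRing

namespace WeierstrassCurve.Affine.CoordinateRing

open Polynomial
open scoped Polynomial.Bivariate

/-! ### Points as homomorphisms from the coordinate ring -/

section Evaluation

variable {F : Type*} [Field F] {W : Affine F} {A : Type*} [CommRing A] [Algebra F A]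

lemma mk_C_eq_algebraMap (p : F[X]) : mk W (C p) = algebraMap F[X] W.CoordinateRing p := rfl

lemma algHom_mk_C (χ : W.CoordinateRing →ₐ[F] A) (p : F[X]) :
    χ (mk W (C p)) = aeval (χ (mk W (C X))) p := by
  have h : χ.comp (IsScalarTower.toAlgHom F F[X] W.CoordinateRing) =
      aeval (χ (mk W (C X))) := by
    ext
    simp
  exact DFunLike.congr_fun h p

lemma algHom_smul_basis (χ : W.CoordinateRing →ₐ[F] A) (p q : F[X]) :
    χ (p • (1 : W.CoordinateRing) + q • mk W Y) =
      aeval (χ (mk W (C X))) p + aeval (χ (mk W (C X))) q * χ (mk W Y) := by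
  rw [map_add, smul, smul, mul_one, map_mul, algHom_mk_C χ p, algHom_mk_C χ q]

lemma algHom_ext {χ ψ : W.CoordinateRing →ₐ[F] A} (hX : χ (mk W (C X)) = ψ (mk W (C X)))
    (hY : χ (mk W Y) = ψ (mk W Y)) : χ = ψ := by
  refine AlgHom.ext fun f => ?_
  obtain ⟨p, q, rfl⟩ := exists_smul_basis_eq f
  rw [algHom_smul_basis, algHom_smul_basis, hX, hY]

lemma eval₂_polynomial (x y : A) :
    W.polynomial.eval₂ (aeval x : F[X] →ₐ[F] A).toRingHom y =
      (W.baseChange A).polynomial.evalEval x y := by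
  rw [evalEval_polynomial, polynomial]
  simp [eval₂_add, eval₂_sub, eval₂_mul, eval₂_pow]
  ring

/-- Evaluation of functions at a point of the curve. -/
noncomputable def evalHom {x y : A} (h : (W.baseChange A).Equation x y) :
    W.CoordinateRing →ₐ[F] A :=
  { AdjoinRoot.lift (aeval x : F[X] →ₐ[F] A).toRingHom y
      ((eval₂_polynomial x y).trans h) with
    commutes' := fun c => by
      have : algebraMap F W.CoordinateRing c = AdjoinRoot.of W.polynomial (C c) := rfl
      simp [this] }

lemma evalHom_X {x y : A} (h : (W.baseChange A).Equation x y) :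
    evalHom h (mk W (C X)) = x := by
  change AdjoinRoot.lift _ _ ((eval₂_polynomial x y).trans h) (AdjoinRoot.of W.polynomial X) = x
  simp

lemma evalHom_Y {x y : A} (h : (W.baseChange A).Equation x y) :
    evalHom h (mk W Y) = y := by
  change AdjoinRoot.lift _ _ ((eval₂_polynomial x y).trans h) (AdjoinRoot.root W.polynomial) = y
  simp

lemma equation_algHom (χ : W.CoordinateRing →ₐ[F] A) :
    (W.baseChange A).Equation (χ (mk W (C X))) (χ (mk W Y)) := by
  have h : mk W W.polynomial = 0 := AdjoinRoot.mk_self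
  have h3 : χ.toRingHom.comp (mk W) = eval₂RingHom
      (aeval (χ (mk W (C X))) : F[X] →ₐ[F] A).toRingHom (χ (mk W Y)) := by
    ext a
    · exact (AlgHom.commutes χ a).trans (by simp)
    · simp
    · simp
  rw [Equation, ← eval₂_polynomial, ← coe_eval₂RingHom, ← h3]
  simp

variable (W A) in
/-- Points of the affine curve are algebra homomorphisms from the coordinate ring. -/
noncomputable def algHomEquiv :
    (W.CoordinateRing →ₐ[F] A) ≃ {P : A × A // (W.baseChange A).Equation P.1 P.2} where
  toFun χ := ⟨(χ (mk W (C X)), χ (mk W Y)), equation_algHom χ⟩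
  invFun P := evalHom P.2
  left_inv _ := algHom_ext (evalHom_X _) (evalHom_Y _)
  right_inv _ := Subtype.ext (Prod.ext (evalHom_X _) (evalHom_Y _))

variable (W) in
lemma equation_neg : (W.baseChange W.CoordinateRing).Equation (mk W (C X))
    (-mk W Y - algebraMap F _ W.a₁ * mk W (C X) - algebraMap F _ W.a₃) := by
  have h := equation_algHom (AlgHom.id F W.CoordinateRing)
  rw [equation_iff] at h ⊢
  simp only [AlgHom.coe_id, id, WeierstrassCurve.baseChange, map_a₁, map_a₂, map_a₃, map_a₄,
    map_a₆] at h ⊢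
  linear_combination h

variable (W) in
/-- The endomorphism of the coordinate ring given by negation on the curve. -/
noncomputable def negHom : W.CoordinateRing →ₐ[F] W.CoordinateRing :=
  evalHom (equation_neg W)

/-- Negation is the conjugation of the quadratic extension of `F[X]`, so it preserves the norm. -/
lemma deg_negHom (f : W.CoordinateRing) : deg (negHom W f) = deg f := by
  obtain ⟨p, q, rfl⟩ := exists_smul_basis_eq f
  have h : negHom W (p • (1 : W.CoordinateRing) + q • mk W Y) =
      (p - q * (C W.a₁ * X + C W.a₃)) • (1 : W.CoordinateRing) + (-q) • mk W Y := by
    rw [algHom_smul_basis, negHom, evalHom_X, evalHom_Y]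
    have hp : ∀ p : F[X], aeval (mk W (C X)) p = mk W (C p) := fun p =>
      (algHom_mk_C (AlgHom.id F _) p).symm
    have hc : ∀ c : F, algebraMap F W.CoordinateRing c = mk W (C (C c)) := fun c => rfl
    simp only [hp, smul, hc, map_sub, map_mul, map_add, map_neg, mul_one]
    ring
  rw [h, deg, deg, norm_smul_basis, norm_smul_basis]
  congr 1
  ring

end Evaluation

/-! ### Stepanov's method -/

section Stepanov

variable {F : Type*} [Field F] {W : Affine F}

variable (W) in
-- The dimension of `degLE W d` grows with `d` except from 0 to 1, the only Weierstrass gap.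
lemma exists_deg_eq {d : ℕ} (hd : d ≠ 1) : ∃ f : W.CoordinateRing, f ≠ 0 ∧ deg f = d := by
  rcases Nat.eq_zero_or_pos d with rfl | hpos
  · exact ⟨1, one_ne_zero, deg_one⟩
  · have hlt : ¬ degLE W d ≤ degLE W (d - 1) := fun h => by
      have := Submodule.finrank_mono h
      rw [finrank_degLE hpos, finrank_degLE (by omega)] at this
      omega
    obtain ⟨f, hf, hf'⟩ := SetLike.not_le_iff_exists.mp hlt
    rw [mem_degLE] at hf hf'
    refine ⟨f, ?_, by omega⟩
    rintro rfl
    rw [deg_zero] at hf'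
    omega

/-- As `deg (c i) < e`, the degrees `deg (c i) + e * deg (b i)` of the nonzero terms are distinct,
so the top term cannot cancel. -/
lemma eq_zero_of_sum_mul_pow_eq_zero {ι : Type*} [Fintype ι] {b c : ι → W.CoordinateRing} {e : ℕ}
    (hb : ∀ i, b i ≠ 0) (hinj : Function.Injective fun i => deg (b i)) (hc : ∀ i, deg (c i) < e)
    (h : ∑ i, c i * b i ^ e = 0) : c = 0 := by
  classical
  by_contra hne
  obtain ⟨j, hj⟩ := Function.ne_iff.mp hne
  obtain ⟨i, hi, hmax⟩ := Finset.exists_max_image (Finset.univ.filter fun i => c i ≠ 0)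
    (fun i => deg (b i)) ⟨j, by simpa using hj⟩
  simp only [Finset.mem_filter, Finset.mem_univ, true_and] at hi hmax
  have hdeg : e * deg (b i) ≤ deg (c i * b i ^ e) := by
    rw [deg_mul hi (pow_ne_zero _ (hb i)), deg_pow]
    omega
  rw [← Finset.add_sum_erase _ _ (Finset.mem_univ i), add_eq_zero_iff_eq_neg] at h
  -- If the largest degree is 0, only one nonzero term remains. This case is separate because the
  -- bound `e * deg (b i) - 1` used below would be truncated.
  rcases Nat.eq_zero_or_pos (deg (b i)) with h0 | hpos
  · rw [Finset.sum_eq_zero, neg_zero] at h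
    · exact (mul_ne_zero hi (pow_ne_zero _ (hb i))) h
    · intro k hk
      by_contra hck
      have hck' : c k ≠ 0 := fun h => hck (by rw [h, zero_mul])
      have := hmax k hck'
      exact Finset.ne_of_mem_erase hk (hinj (by simp only; omega))
  · have hmem : ∑ k ∈ Finset.univ.erase i, c k * b k ^ e ∈ degLE W (e * deg (b i) - 1) := by
      refine Submodule.sum_mem _ fun k hk => ?_
      rw [mem_degLE]
      by_cases hck : c k = 0
      · rw [hck, zero_mul, deg_zero]
        exact Nat.zero_le _
      · rw [deg_mul hck (pow_ne_zero _ (hb k)), deg_pow]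
        have h1 : deg (b k) < deg (b i) :=
          lt_of_le_of_ne (hmax k hck) fun h => Finset.ne_of_mem_erase hk (hinj h)
        have h2 := hc k
        have h3 : e * (deg (b k) + 1) ≤ e * deg (b i) := Nat.mul_le_mul_left e h1
        rw [mul_add] at h3
        omega
    rw [h, deg_neg] at hdeg
    have := mem_degLE.mp hmem
    have := hc i
    have : 0 < e * deg (b i) := Nat.mul_pos (by omega) hpos
    omega

/-- The number of points whose Frobenius image is the image under a degree preserving endomorphism
of the coordinate ring exceeds the size `r ^ 2` of the field by at most `3 * r`. -/
theorem card_twisted_le [Finite F] {p k : ℕ} [Fact p.Prime] [CharP F p]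
    (hF : Nat.card F = (p ^ k) ^ 2) (hr : 4 < p ^ k) (τ : W.CoordinateRing →ₐ[F] W.CoordinateRing)
    (hτ : ∀ f, deg (τ f) = deg f) (K : Type*) [Field K] [Algebra F K] :
    Finite {χ : W.CoordinateRing →ₐ[F] K // ∀ f, χ f ^ (p ^ k) ^ 2 = χ (τ f)} ∧
      Nat.card {χ : W.CoordinateRing →ₐ[F] K // ∀ f, χ f ^ (p ^ k) ^ 2 = χ (τ f)} ≤
        (p ^ k) ^ 2 + 3 * p ^ k := by
  have : CharP W.CoordinateRing p :=
    charP_of_injective_algebraMap (algebraMap F W.CoordinateRing).injective p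
  have : ExpChar W.CoordinateRing p := .prime Fact.out
  have hsub : ∀ u v : W.CoordinateRing, (u - v) ^ p ^ k = u ^ p ^ k - v ^ p ^ k := fun u v =>
    sub_pow_char_pow u v k
  have hsump : ∀ (n : ℕ) (f : Fin n → W.CoordinateRing), (∑ i, f i) ^ p ^ k = ∑ i, f i ^ p ^ k :=
    fun n f => sum_pow_char_pow p k Finset.univ f
  generalize p ^ k = r at *
  -- The degrees are `0, 2, 3, …, r + 2`, skipping the gap.
  have hb : ∀ j : Fin (r + 2), ∃ f : W.CoordinateRing,
      f ≠ 0 ∧ deg f = if (j : ℕ) = 0 then 0 else (j : ℕ) + 1 := fun j =>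
    exists_deg_eq W (by split_ifs <;> omega)
  choose b hb0 hbd using hb
  have hbinj : Function.Injective fun j => deg (b j) := by
    intro i j hij
    simp only [hbd] at hij
    ext
    split_ifs at hij <;> omega
  have hble : ∀ j, deg (b j) ≤ r + 2 := fun j => by
    rw [hbd]
    have := j.2
    split_ifs <;> omega
  let Ψ : (Fin (r + 2) → degLE W (r - 1)) → degLE W ((r - 1) * r + (r + 2)) := fun s =>
    ⟨∑ j, (s j : W.CoordinateRing) ^ r * τ (b j), Submodule.sum_mem _ fun j _ => by
      rw [mem_degLE]
      refine (deg_mul_le _ _).trans (add_le_add ?_ (by rw [hτ]; exact hble j))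
      rw [deg_pow, mul_comm]
      exact Nat.mul_le_mul_right r (mem_degLE.mp (s j).2)⟩
  -- `Ψ` is linear only up to a Frobenius twist, so cardinalities are compared. The dimensions over
  -- `F` are `(r + 2)(r - 1) = r² + r - 2` and `r² + 2`, and the first is larger as `r > 4`.
  have hΨ : ∃ s t, s ≠ t ∧ Ψ s = Ψ t := by
    by_contra! hcon
    have hinj : Function.Injective Ψ := fun s t h => by
      by_contra hne
      exact hcon s t hne h
    have : Finite (degLE W ((r - 1) * r + (r + 2))) := Module.finite_of_finite F
    have hle := Nat.card_le_card_of_injective Ψ hinj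
    rw [Nat.card_fun, Module.natCard_eq_pow_finrank (K := F) (V := degLE W (r - 1)),
      Module.natCard_eq_pow_finrank (K := F) (V := degLE W ((r - 1) * r + (r + 2))), finrank_degLE (by omega), finrank_degLE (by omega),
      Nat.card_fin, ← pow_mul, Nat.pow_le_pow_iff_right Finite.one_lt_card] at hle
    obtain ⟨u, rfl⟩ : ∃ u, r = u + 5 := ⟨r - 5, by omega⟩
    rw [show u + 5 - 1 = u + 4 by omega] at hle
    nlinarith
  obtain ⟨s, t, hst, hΨst⟩ := hΨ
  let c : Fin (r + 2) → W.CoordinateRing := fun j => (s j - t j : W.CoordinateRing)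
  have hc0 : c ≠ 0 := fun h => hst (funext fun j => Subtype.ext (sub_eq_zero.mp (congrFun h j)))
  have hcd : ∀ j, deg (c j) ≤ r - 1 := fun j =>
    mem_degLE.mp ((degLE W (r - 1)).sub_mem (s j).2 (t j).2)
  have hsum : ∑ j, c j ^ r * τ (b j) = 0 := by
    have h := congrArg Subtype.val hΨst
    simp only [Ψ] at h
    rw [← sub_eq_zero, ← Finset.sum_sub_distrib] at h
    rw [← h]
    refine Finset.sum_congr rfl fun j _ => ?_
    rw [← sub_mul, ← hsub]
  -- At a counted point `b j ^ r²` takes the value of `τ (b j)`, so `g ^ r` takes the value of the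
  -- vanishing sum `hsum`. Passing to the `r`-th root `g` divides the degree by `r`.
  let g := ∑ j, c j * b j ^ r
  have hg : g ≠ 0 := fun h => hc0
    (eq_zero_of_sum_mul_pow_eq_zero hb0 hbinj (fun j => by have := hcd j; omega) h)
  have hgd : deg g ≤ r ^ 2 + 3 * r := by
    have : deg g ≤ (r - 1) + r * (r + 2) := mem_degLE.mp <| Submodule.sum_mem _ fun j _ => by
      rw [mem_degLE]
      refine (deg_mul_le _ _).trans (add_le_add (hcd j) ?_)
      rw [deg_pow]
      exact Nat.mul_le_mul_left r (hble j)
    have h2 : r * (r + 2) = r ^ 2 + 2 * r := by ring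
    omega
  have hgr : g ^ r = ∑ j, c j ^ r * b j ^ r ^ 2 := by
    simp only [g]
    rw [hsump]
    refine Finset.sum_congr rfl fun j _ => ?_
    rw [mul_pow, ← pow_mul, sq]
  have hvan : ∀ χ : W.CoordinateRing →ₐ[F] K, (∀ f, χ f ^ r ^ 2 = χ (τ f)) → χ g = 0 := by
    intro χ hχ
    have h : χ (g ^ r) = χ (∑ j, c j ^ r * τ (b j)) := by
      rw [hgr, map_sum, map_sum]
      refine Finset.sum_congr rfl fun j _ => ?_
      rw [map_mul, map_mul, map_pow χ (b j), hχ]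
    rw [hsum, map_zero, map_pow] at h
    exact pow_eq_zero_iff (by omega) |>.mp h
  obtain ⟨hfin, hcard⟩ := card_algHom_le_deg (K := K) hg
  let ι : {χ : W.CoordinateRing →ₐ[F] K // ∀ f, χ f ^ r ^ 2 = χ (τ f)} →
      {χ : W.CoordinateRing →ₐ[F] K // χ g = 0} := fun χ => ⟨χ.1, hvan χ.1 χ.2⟩
  have hι : Function.Injective ι := fun χ ψ h =>
    Subtype.ext (congrArg (fun ξ => ξ.1) h)
  exact ⟨Finite.of_injective ι hι, (Nat.card_le_card_of_injective ι hι).trans (hcard.trans hgd)⟩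

end Stepanov

end WeierstrassCurve.Affine.CoordinateRing

namespace WeierstrassCurve.Affine.CoordinateRing

open Polynomial
open scoped Polynomial.Bivariate

/-! ### A weak Hasse bound over fields of square cardinality -/

section HasseBound

variable {F : Type*} [Field F] {W : Affine F}

lemma exists_algebraMap_eq_of_pow_card_eq [Finite F] {K : Type*} [Field K] [Algebra F K] {y : K}
    (hy : y ^ Nat.card F = y) : ∃ z : F, algebraMap F K z = y := by
  have := Fintype.ofFinite F
  classical
  have hne : (X ^ Fintype.card F - X : K[X]) ≠ 0 :=
    FiniteField.X_pow_card_sub_X_ne_zero K Fintype.one_lt_card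
  have hsub : Finset.univ.image (algebraMap F K) ⊆
      (X ^ Fintype.card F - X : K[X]).roots.toFinset := by
    intro z hz
    obtain ⟨w, -, rfl⟩ := Finset.mem_image.mp hz
    rw [Multiset.mem_toFinset, mem_roots hne, IsRoot.def]
    simp [← map_pow, FiniteField.pow_card]
  have hcard : (X ^ Fintype.card F - X : K[X]).roots.toFinset.card ≤
      (Finset.univ.image (algebraMap F K)).card := by
    rw [Finset.card_image_of_injective _ (algebraMap F K).injective, Finset.card_univ]
    exact (Multiset.toFinset_card_le _).trans ((card_roots' _).trans
      (FiniteField.X_pow_card_sub_X_natDegree_eq K Fintype.one_lt_card).le)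
  have hmem : y ∈ (X ^ Fintype.card F - X : K[X]).roots.toFinset := by
    rw [Multiset.mem_toFinset, mem_roots hne, IsRoot.def]
    simp [← Nat.card_eq_fintype_card, hy]
  rw [← Finset.eq_of_subset_of_card_le hsub hcard] at hmem
  simpa using hmem

/-- The evaluation homomorphism at a conjugate point. -/
lemma equation_neg_of_equation {A : Type*} [CommRing A] [Algebra F A] {x y : A}
    (h : (W.baseChange A).Equation x y) :
    (W.baseChange A).Equation x ((W.baseChange A).negY x y) :=
  (Affine.equation_neg x y).mpr h

lemma evalHom_pow_card [Finite F] {K : Type*} [Field K] [Algebra F K] {x y : K}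
    (h : (W.baseChange K).Equation x y) (hx : x ^ Nat.card F = x)
    (hy : y ^ Nat.card F = (W.baseChange K).negY x y) (f : W.CoordinateRing) :
    evalHom h f ^ Nat.card F = evalHom h (negHom W f) := by
  have := Fintype.ofFinite F
  have key : (FiniteField.frobeniusAlgHom F K).comp (evalHom h) =
      (evalHom h).comp (negHom W) := by
    apply algHom_ext
    · simp only [AlgHom.comp_apply, evalHom_X, negHom, FiniteField.frobeniusAlgHom_apply,
        ← Nat.card_eq_fintype_card, hx]
    · simp only [AlgHom.comp_apply, evalHom_X, evalHom_Y, negHom,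
        FiniteField.frobeniusAlgHom_apply, ← Nat.card_eq_fintype_card, hy, map_sub, map_neg,
        map_mul, AlgHom.commutes, Affine.negY]
      rfl
  simpa [← Nat.card_eq_fintype_card] using DFunLike.congr_fun key f

lemma exists_equation {K : Type*} [Field K] [Algebra F K] [IsAlgClosed K] (x : K) :
    ∃ y, (W.baseChange K).Equation x y := by
  obtain ⟨y, hy⟩ := IsAlgClosed.exists_root (X ^ 2 + C ((W.baseChange K).a₁ * x +
    (W.baseChange K).a₃) * X + C (-(x ^ 3 + (W.baseChange K).a₂ * x ^ 2 + (W.baseChange K).a₄ * x +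
      (W.baseChange K).a₆)) : K[X]) (by rw [← one_mul (X ^ 2), ← C_1, degree_quadratic one_ne_zero]
                                        exact two_ne_zero)
  refine ⟨y, ?_⟩
  rw [equation_iff']
  simp only [IsRoot.def, eval_add, eval_pow, eval_X, eval_mul, eval_C] at hy
  linear_combination hy

lemma equation_pow_card [Finite F] {K : Type*} [Field K] [Algebra F K] {x y : K}
    (h : (W.baseChange K).Equation x y) :
    (W.baseChange K).Equation (x ^ Nat.card F) (y ^ Nat.card F) := by
  have := Fintype.ofFinite F
  have h2 := equation_algHom ((FiniteField.frobeniusAlgHom F K).comp (evalHom h))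
  rwa [AlgHom.comp_apply, AlgHom.comp_apply, evalHom_X, evalHom_Y,
    FiniteField.frobeniusAlgHom_apply, FiniteField.frobeniusAlgHom_apply,
    ← Nat.card_eq_fintype_card] at h2

/-- The set of evaluations at geometric points on which Frobenius acts as negation. -/
abbrev AntiRational (W : Affine F) (K : Type*) [Field K] [Algebra F K] : Type _ :=
  {χ : W.CoordinateRing →ₐ[F] K // ∀ f, χ f ^ Nat.card F = χ (negHom W f)}

/-- The `X`-coordinate of a point. -/
noncomputable def xCoord {K : Type*} [Field K] [Algebra F K] [Finite F] :
    (W.CoordinateRing →ₐ[F] F) ⊕ AntiRational W K → K :=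
  Sum.elim (fun χ => algebraMap F K (χ (mk W (C X)))) (fun χ => χ.1 (mk W (C X)))

/-- The two points above `x` are negatives of each other. Either they are rational, or Frobenius
swaps them and so acts on both as negation. -/
lemma exists_two_points [Finite F] {K : Type*} [Field K] [Algebra F K] [IsAlgClosed K] (x : F) :
    ∃ a b : (W.CoordinateRing →ₐ[F] F) ⊕ AntiRational W K, a ≠ b ∧
      xCoord a = algebraMap F K x ∧ xCoord b = algebraMap F K x := by
  have hxq : algebraMap F K x ^ Nat.card F = algebraMap F K x := by
    have := Fintype.ofFinite F
    rw [← map_pow, Nat.card_eq_fintype_card, FiniteField.pow_card]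
  by_cases h : ∃ y, (W.baseChange F).Equation x y
  · obtain ⟨y, hy⟩ := h
    by_cases hyn : y = (W.baseChange F).negY x y
    -- A rational point equal to its negative belongs to both sets and is counted once in each.
    · have hyK : (W.baseChange K).Equation (algebraMap F K x) (algebraMap F K y) :=
        Equation.baseChange (Algebra.ofId F K) hy
      refine ⟨.inl (evalHom hy), .inr ⟨evalHom hyK, fun f => evalHom_pow_card hyK hxq ?_ f⟩,
        by simp, congrArg _ (evalHom_X hy), evalHom_X hyK⟩
      have := Fintype.ofFinite F
      rw [← map_pow, Nat.card_eq_fintype_card, FiniteField.pow_card]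
      nth_rewrite 1 [hyn]
      simp [Affine.negY]
    · refine ⟨.inl (evalHom hy), .inl (evalHom (equation_neg_of_equation hy)), ?_,
        congrArg _ (evalHom_X hy), congrArg _ (evalHom_X _)⟩
      intro heq
      apply hyn
      have := DFunLike.congr_fun (Sum.inl_injective heq) (mk W Y)
      rwa [evalHom_Y, evalHom_Y] at this
  · obtain ⟨y, hy⟩ := exists_equation (W := W) (algebraMap F K x)
    have hne : y ^ Nat.card F ≠ y := by
      intro hyq
      obtain ⟨z, rfl⟩ := exists_algebraMap_eq_of_pow_card_eq hyq
      exact h ⟨z, (baseChange_equation W (f := Algebra.ofId F K) (algebraMap F K).injective x z).mp hy⟩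
    have hyq : y ^ Nat.card F = (W.baseChange K).negY (algebraMap F K x) y := by
      have h2 := equation_pow_card hy
      rw [hxq] at h2
      exact (Y_eq_of_X_eq h2 hy rfl).resolve_left hne
    have hyq' : ((W.baseChange K).negY (algebraMap F K x) y) ^ Nat.card F =
        (W.baseChange K).negY (algebraMap F K x) ((W.baseChange K).negY (algebraMap F K x) y) := by
      have h2 := equation_pow_card (equation_neg_of_equation hy)
      rw [hxq] at h2
      refine (Y_eq_of_X_eq h2 (equation_neg_of_equation hy) rfl).resolve_left fun h3 => ?_
      rw [← hyq] at h3
      have := Fintype.ofFinite F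
      exact hne ((FiniteField.frobeniusAlgHom F K).toRingHom.injective
        (by simpa [← Nat.card_eq_fintype_card] using h3))
    refine ⟨.inr ⟨evalHom hy, evalHom_pow_card hy hxq hyq⟩,
      .inr ⟨evalHom (equation_neg_of_equation hy), evalHom_pow_card _ hxq hyq'⟩, ?_,
        evalHom_X hy, evalHom_X (equation_neg_of_equation hy)⟩
    intro heq
    have := DFunLike.congr_fun (congrArg Subtype.val (Sum.inr_injective heq)) (mk W Y)
    rw [evalHom_Y, evalHom_Y, ← hyq] at this
    exact hne this.symm

/-- A Hasse-type bound for the number of affine points over a field with `(p ^ k) ^ 2` elements. -/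
theorem abs_card_algHom_sub_le [Finite F] {p k : ℕ} [Fact p.Prime] [CharP F p]
    (hF : Nat.card F = (p ^ k) ^ 2) (hr : 4 < p ^ k) :
    |(Nat.card (W.CoordinateRing →ₐ[F] F) : ℤ) - Nat.card F| ≤ 3 * p ^ k := by
  have := Fintype.ofFinite F
  let K := AlgebraicClosure F
  obtain ⟨hfin₁, hcard₁⟩ := card_twisted_le (W := W) hF hr (AlgHom.id F _) (fun _ => rfl) F
  obtain ⟨hfin₂, hcard₂⟩ := card_twisted_le (W := W) hF hr (negHom W) deg_negHom K
  let e : (W.CoordinateRing →ₐ[F] F) ≃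
      {χ : W.CoordinateRing →ₐ[F] F // ∀ f, χ f ^ (p ^ k) ^ 2 = χ (AlgHom.id F _ f)} :=
    (Equiv.subtypeUnivEquiv fun χ f => by
      rw [← hF, Nat.card_eq_fintype_card, FiniteField.pow_card, AlgHom.id_apply]).symm
  have : Finite (W.CoordinateRing →ₐ[F] F) := .of_equiv _ e.symm
  rw [← Nat.card_congr e] at hcard₁
  rw [← hF] at hfin₂ hcard₂
  -- Twice the cardinality of `F` is at most the sum of the two counts, so the upper bound `hcard₂`
  -- becomes a lower bound for the first.
  choose a b hab ha hb using exists_two_points (W := W) (K := K)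
  let φ : F × Bool → (W.CoordinateRing →ₐ[F] F) ⊕ AntiRational W K :=
    fun xb => if xb.2 then a xb.1 else b xb.1
  have hφ : Function.Injective φ := by
    rintro ⟨x, s⟩ ⟨y, t⟩ h
    have hx : xCoord (φ (x, s)) = algebraMap F K x := by
      cases s <;> simp [φ, ha, hb]
    have hy : xCoord (φ (y, t)) = algebraMap F K y := by
      cases t <;> simp [φ, ha, hb]
    rw [h, hy] at hx
    obtain rfl := (algebraMap F K).injective hx
    have h1 := hab y
    have h2 := h1.symm
    cases s <;> cases t <;> simp_all [φ]
  have hle := Nat.card_le_card_of_injective φ hφ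
  rw [Nat.card_prod, Nat.card_sum, Nat.card_eq_fintype_card (α := Bool), Fintype.card_bool] at hle
  rw [abs_le]
  zify at hcard₁ hcard₂ hle hF
  constructor <;> linarith

end HasseBound

end WeierstrassCurve.Affine.CoordinateRing

namespace WeierstrassCurve.Affine.CoordinateRing

open Polynomial
open scoped Polynomial.Bivariate nonZeroDivisors

/-! ### Codimension of ideals; the coordinate ring is a Dedekind domain -/

section Codimension

variable {F : Type*} [Field F] {W : Affine F}

/-- The dimension of the quotient of the coordinate ring by an ideal. -/
noncomputable def codim (I : Ideal W.CoordinateRing) : ℕ :=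
  Module.finrank F (W.CoordinateRing ⧸ I)

lemma codim_span {f : W.CoordinateRing} (hf : f ≠ 0) : codim (Ideal.span {f}) = deg f :=
  finrank_quotient_span hf

lemma codim_top : codim (⊤ : Ideal W.CoordinateRing) = 0 :=
  Module.finrank_zero_of_subsingleton

lemma codim_eq_zero {I : Ideal W.CoordinateRing} (hI : I ≠ ⊥) : codim I = 0 ↔ I = ⊤ := by
  have := finite_quotient (F := F) hI
  rw [codim, Module.finrank_zero_iff, Ideal.Quotient.subsingleton_iff]

/-- Multiplication by `a` gives an exact sequence `0 → R/K → R/J → R/I → 0`, where `R` is the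
coordinate ring. -/
lemma codim_eq_add {I J K : Ideal W.CoordinateRing} (hJ : J ≠ ⊥) (a : W.CoordinateRing)
    (hI : Ideal.span {a} ⊔ J = I) (hK : ∀ r, r * a ∈ J ↔ r ∈ K) :
    codim J = codim I + codim K := by
  have := finite_quotient (F := F) hJ
  let ψ : (W.CoordinateRing ⧸ J) →ₗ[W.CoordinateRing] (W.CoordinateRing ⧸ I) :=
    Submodule.factor (hI ▸ le_sup_right)
  let φ : (W.CoordinateRing ⧸ K) →ₗ[W.CoordinateRing] (W.CoordinateRing ⧸ J) :=
    Submodule.mapQ K J (LinearMap.toSpanSingleton _ _ a) fun r hr => (hK r).mpr hr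
  have hφ : Function.Injective φ := by
    rw [← LinearMap.ker_eq_bot, LinearMap.ker_eq_bot']
    intro m hm
    obtain ⟨r, rfl⟩ := Submodule.Quotient.mk_surjective K m
    rw [Submodule.Quotient.mk_eq_zero]
    exact (hK r).mp ((Submodule.Quotient.mk_eq_zero J).mp hm)
  have hψ : Function.Surjective ψ := Submodule.factor_surjective _
  have hexact : LinearMap.ker ψ = LinearMap.range φ := by
    ext m
    obtain ⟨r, rfl⟩ := Submodule.Quotient.mk_surjective J m
    rw [LinearMap.mem_ker]
    change Submodule.Quotient.mk r = 0 ↔ _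
    rw [Submodule.Quotient.mk_eq_zero, ← hI, Ideal.mem_span_singleton_sup]
    constructor
    · rintro ⟨s, j, hj, rfl⟩
      refine ⟨Submodule.Quotient.mk s, ?_⟩
      change Submodule.Quotient.mk (s * a) = _
      rw [Submodule.Quotient.eq]
      simpa using hj
    · rintro ⟨n, hn⟩
      obtain ⟨s, rfl⟩ := Submodule.Quotient.mk_surjective K n
      replace hn : Submodule.Quotient.mk (s * a) = Submodule.Quotient.mk r := hn
      rw [Submodule.Quotient.eq] at hn
      exact ⟨s, r - s * a, by simpa using J.neg_mem hn, by ring⟩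
  have h1 := LinearMap.finrank_range_add_finrank_ker (ψ.restrictScalars F)
  have h2 : Module.finrank F (LinearMap.range (ψ.restrictScalars F)) = codim I := by
    have : LinearMap.range (ψ.restrictScalars F) = ⊤ := LinearMap.range_eq_top.mpr hψ
    rw [this, finrank_top, codim]
  have h3 : Module.finrank F (LinearMap.ker (ψ.restrictScalars F)) = codim K := by
    have : LinearMap.ker (ψ.restrictScalars F) = LinearMap.range (φ.restrictScalars F) := by
      ext m
      exact SetLike.ext_iff.mp hexact m
    rw [this]
    exact LinearMap.finrank_range_of_inj (f := φ.restrictScalars F) hφ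
  rw [h2, h3] at h1
  exact h1.symm

lemma codim_span_mul {f : W.CoordinateRing} (hf : f ≠ 0) {I : Ideal W.CoordinateRing}
    (hI : I ≠ ⊥) : codim (Ideal.span {f} * I) = deg f + codim I := by
  rw [codim_eq_add (I := Ideal.span {f}) (J := Ideal.span {f} * I) (K := I) _ f (sup_eq_left.mpr Ideal.mul_le_left),
    codim_span hf]
  · intro r
    rw [Ideal.mem_span_singleton_mul]
    constructor
    · rintro ⟨z, hz, h⟩
      rw [mul_comm r, mul_right_inj' hf] at h
      exact h ▸ hz
    · exact fun hr => ⟨r, hr, mul_comm _ _⟩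
  · rw [Ne, Ideal.mul_eq_bot]
    exact not_or.mpr ⟨mt Ideal.span_singleton_eq_bot.mp hf, hI⟩

lemma eq_of_le_of_codim_le {I J : Ideal W.CoordinateRing} (hI : I ≠ ⊥) (hIJ : I ≤ J)
    (h : codim I ≤ codim J) : I = J := by
  have := finite_quotient (F := F) hI
  let ψ : (W.CoordinateRing ⧸ I) →ₗ[F] (W.CoordinateRing ⧸ J) :=
    (Ideal.Quotient.factorₐ F hIJ).toLinearMap
  have hψ : Function.Surjective ψ := Ideal.Quotient.factor_surjective hIJ
  have hle : codim J ≤ codim I := LinearMap.finrank_le_finrank_of_surjective hψ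
  have : Module.Finite F (W.CoordinateRing ⧸ J) := .of_surjective _ hψ
  have hinj := (LinearMap.injective_iff_surjective_of_finrank_eq_finrank (le_antisymm h hle)).mpr hψ
  refine le_antisymm hIJ fun r hr => ?_
  rw [← Ideal.Quotient.eq_zero_iff_mem]
  apply hinj
  rw [map_zero]
  exact Ideal.Quotient.eq_zero_iff_mem.mpr hr

lemma codim_le_of_le {I J : Ideal W.CoordinateRing} (hI : I ≠ ⊥) (hIJ : I ≤ J) :
    codim J ≤ codim I := by
  have := finite_quotient (F := F) hI
  let ψ : (W.CoordinateRing ⧸ I) →ₗ[F] (W.CoordinateRing ⧸ J) :=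
    (Ideal.Quotient.factorₐ F hIJ).toLinearMap
  have hψ : Function.Surjective ψ := Ideal.Quotient.factor_surjective hIJ
  exact LinearMap.finrank_le_finrank_of_surjective hψ

/-- A space of functions of dimension `codim I + 1` cannot inject into the quotient by `I`. -/
lemma exists_mem_deg_le {I : Ideal W.CoordinateRing} (hI : I ≠ ⊥) :
    ∃ f ∈ I, f ≠ 0 ∧ deg f ≤ codim I + 1 := by
  have := finite_quotient (F := F) hI
  let φ : degLE W (codim I + 1) →ₗ[F] (W.CoordinateRing ⧸ I) :=
    (Ideal.Quotient.mkₐ F I).toLinearMap.comp (degLE W (codim I + 1)).subtype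
  have hker : LinearMap.ker φ ≠ ⊥ := LinearMap.ker_ne_bot_of_finrank_lt <| by
    rw [finrank_degLE (by omega)]
    exact Nat.lt_succ_self _
  obtain ⟨f, hf, hf0⟩ := Submodule.exists_mem_ne_zero_of_ne_bot hker
  exact ⟨f, Ideal.Quotient.eq_zero_iff_mem.mp hf, fun h => hf0 (Subtype.ext h),
    mem_degLE.mp f.2⟩

lemma XYIdeal_ne_bot (x : F) (y : F[X]) : XYIdeal W x y ≠ ⊥ := by
  intro h
  have : XClass W x ∈ XYIdeal W x y := Ideal.subset_span (by simp)
  rw [h, Ideal.mem_bot] at this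
  exact XClass_ne_zero x this

lemma codim_XYIdeal {x y : F} (h : W.Equation x y) : codim (XYIdeal W x (C y)) = 1 := by
  rw [codim, (quotientXYIdealEquiv (W' := W) (x := x) (y := C y) h).toLinearEquiv.finrank_eq,
    Module.finrank_self]

lemma deg_XClass (x : F) : deg (XClass W x) = 2 := by
  have h : XClass W x = (X - C x) • (1 : W.CoordinateRing) + (0 : F[X]) • mk W Y := by
    rw [smul, zero_smul, add_zero, mul_one, XClass]
  rw [h, deg, norm_smul_basis]
  simp [natDegree_pow]

lemma exists_eq_XYIdeal {K : Ideal W.CoordinateRing} (h : codim K = 1) :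
    ∃ x y : F, W.Equation x y ∧ K = XYIdeal W x (C y) := by
  have hbij := Algebra.finrank_eq_one_iff_bijective_algebraMap.mp h
  let e : F ≃ₐ[F] (W.CoordinateRing ⧸ K) := AlgEquiv.ofBijective (Algebra.ofId F _) hbij
  let χ : W.CoordinateRing →ₐ[F] F := e.symm.toAlgHom.comp (Ideal.Quotient.mkₐ F K)
  have hχ : ∀ f, χ f = 0 → f ∈ K := fun f hf => by
    rw [← Ideal.Quotient.eq_zero_iff_mem]
    exact (map_eq_zero_iff e.symm e.symm.injective).mp hf
  have heq : W.Equation (χ (mk W (C X))) (χ (mk W Y)) := by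
    have := equation_algHom χ
    rwa [equation_iff] at this ⊢
  refine ⟨χ (mk W (C X)), χ (mk W Y), heq, (eq_of_le_of_codim_le (XYIdeal_ne_bot _ _) ?_ ?_).symm⟩
  · rw [XYIdeal, Ideal.span_le, Set.pair_subset_iff]
    constructor
    · apply hχ
      rw [XClass, algHom_mk_C]
      simp
    · apply hχ
      rw [YClass, map_sub, map_sub, algHom_mk_C]
      simp
  · rw [codim_XYIdeal heq, h]

/-- The ideal of functions vanishing at a point, which is the unit ideal for the point at
infinity. -/
noncomputable def pointIdeal : W.Point → Ideal W.CoordinateRing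
  | .zero => ⊤
  | .some x y _ => XYIdeal W x (C y)

lemma pointIdeal_ne_bot (P : W.Point) : pointIdeal P ≠ ⊥ := by
  cases P
  · exact top_ne_bot
  · exact XYIdeal_ne_bot _ _

/-- Every ideal becomes principal after multiplication by the ideal of a point. -/
theorem exists_mul_pointIdeal_eq_span [W.IsElliptic] {I : Ideal W.CoordinateRing} (hI : I ≠ ⊥) :
    ∃ (P : W.Point) (f : W.CoordinateRing), f ≠ 0 ∧ I * pointIdeal P = Ideal.span {f} := by
  obtain ⟨f, hfI, hf, hdeg⟩ := exists_mem_deg_le hI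
  have hfbot : Ideal.span {f} ≠ ⊥ := mt Ideal.span_singleton_eq_bot.mp hf
  have hle : Ideal.span {f} ≤ I := (Ideal.span_singleton_le_iff_mem I).mpr hfI
  by_cases hd : deg f ≤ codim I
  · exact ⟨.zero, f, hf, (Ideal.mul_top I).trans
      (eq_of_le_of_codim_le hfbot hle ((codim_span hf).trans_le hd)).symm⟩
  obtain ⟨g, hgI, hgf⟩ := SetLike.not_le_iff_exists.mp fun h : I ≤ Ideal.span {f} =>
    hd ((codim_span hf).symm.trans_le (codim_le_of_le hI h))
  have hsup : Ideal.span {g} ⊔ Ideal.span {f} = I := by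
    have hle' : Ideal.span {g} ⊔ Ideal.span {f} ≤ I :=
      sup_le ((Ideal.span_singleton_le_iff_mem I).mpr hgI) hle
    refine eq_of_le_of_codim_le (ne_bot_of_le_ne_bot hfbot le_sup_right) hle' ?_
    by_contra! hlt
    have h2 : codim (Ideal.span {f}) ≤ codim (Ideal.span {g} ⊔ Ideal.span {f}) := by
      rw [codim_span hf]
      omega
    have h3 := eq_of_le_of_codim_le hfbot le_sup_right h2
    exact hgf (h3 ▸ Ideal.mem_sup_left (Ideal.mem_span_singleton_self g))
  -- `K` is the colon ideal `((f) : g)`. Its codimension is `deg f - codim I = 1`, so it is the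
  -- ideal of an affine rational point.
  let K : Ideal W.CoordinateRing := LinearMap.ker
    ((Submodule.mkQ (Ideal.span {f})).comp (LinearMap.toSpanSingleton W.CoordinateRing _ g))
  have hK : ∀ r, r * g ∈ Ideal.span {f} ↔ r ∈ K := fun r => by
    rw [LinearMap.mem_ker]
    exact (Submodule.Quotient.mk_eq_zero _).symm
  have hKbot : K ≠ ⊥ := fun h => hf <| by
    rw [← Ideal.mem_bot, ← h, ← hK, mul_comm]
    exact Ideal.mul_mem_left _ _ (Ideal.mem_span_singleton_self f)
  have hcodim := codim_eq_add hfbot g hsup hK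
  rw [codim_span hf] at hcodim
  obtain ⟨x, y, hxy, hKeq⟩ := exists_eq_XYIdeal (K := K) (by omega)
  have hns : W.Nonsingular x y := equation_iff_nonsingular.mp hxy
  have hneg : W.Equation x (W.negY x y) := (Affine.equation_neg x y).mpr hxy
  have hmul := XYIdeal_neg_mul hns
  have hle2 : I * XYIdeal W x (C y) ≤ Ideal.span {f} := by
    rw [← hsup, Ideal.sup_mul, ← hKeq]
    refine sup_le (Ideal.mul_le.mpr fun a ha r hr => ?_) Ideal.mul_le_left
    obtain ⟨b, rfl⟩ := Ideal.mem_span_singleton'.mp ha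
    rw [mul_assoc, mul_comm g]
    exact Ideal.mul_mem_left _ _ ((hK r).mpr hr)
  have hX := XClass_ne_zero (W' := W) x
  have hXI : XIdeal W x ≠ ⊥ := mt Ideal.span_singleton_eq_bot.mp hX
  -- Additivity of codimension is so far known only for a principal factor. Multiplying by `XIdeal`,
  -- the product of the ideals of the point and its negative, makes it apply to both sides.
  have heq : XIdeal W x * I = Ideal.span {f} * XYIdeal W x (C (W.negY x y)) := by
    refine eq_of_le_of_codim_le (by rw [Ne, Ideal.mul_eq_bot]; exact not_or.mpr ⟨hXI, hI⟩) ?_ ?_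
    · rw [← hmul, mul_assoc, mul_comm, mul_comm _ I]
      exact Ideal.mul_mono_left hle2
    · rw [XIdeal, codim_span_mul hX hI, codim_span_mul hf (XYIdeal_ne_bot _ _),
        codim_XYIdeal hneg, deg_XClass]
      omega
  refine ⟨.some x y hns, f, hf, ?_⟩
  change I * XYIdeal W x (C y) = _
  have h2 : XIdeal W x * (I * XYIdeal W x (C y)) = XIdeal W x * Ideal.span {f} := by
    rw [← mul_assoc, heq, mul_assoc, hmul, mul_comm]
  exact (Ideal.span_singleton_mul_right_inj hX).mp h2

/-- If `J * pointIdeal P = (f)`, the fractional ideal `a⁻¹ J` has inverse `(a / f) * pointIdeal P`.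
-/
instance isDedekindDomain [W.IsElliptic] : IsDedekindDomain W.CoordinateRing := by
  rw [isDedekindDomain_iff_mul_inv_cancel (K := W.FunctionField)]
  intro I hI
  rw [FractionalIdeal.mul_inv_cancel_iff]
  obtain ⟨a, J, ha, rfl⟩ := FractionalIdeal.exists_eq_spanSingleton_mul I
  have hJ : J ≠ ⊥ := by
    rintro rfl
    simp at hI
  obtain ⟨P, f, hf, hPf⟩ := exists_mul_pointIdeal_eq_span hJ
  have hmap : ∀ b : W.CoordinateRing, b ≠ 0 → algebraMap _ W.FunctionField b ≠ 0 := fun b hb =>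
    (map_ne_zero_iff _ (IsFractionRing.injective W.CoordinateRing W.FunctionField)).mpr hb
  refine ⟨FractionalIdeal.spanSingleton _ (algebraMap _ _ a * (algebraMap _ _ f)⁻¹) *
    (pointIdeal P : FractionalIdeal W.CoordinateRing⁰ W.FunctionField), ?_⟩
  rw [mul_mul_mul_comm, FractionalIdeal.spanSingleton_mul_spanSingleton,
    ← FractionalIdeal.coeIdeal_mul, hPf, FractionalIdeal.coeIdeal_span_singleton,
    FractionalIdeal.spanSingleton_mul_spanSingleton, ← mul_assoc, inv_mul_cancel₀ (hmap a ha),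
    one_mul, inv_mul_cancel₀ (hmap f hf), FractionalIdeal.spanSingleton_one]

/-- Choosing `a` with `I = I * J + (a)`, multiplication by `a` identifies the quotient by `J` with
`I / (I * J)`. -/
lemma codim_mul [W.IsElliptic] {I J : Ideal W.CoordinateRing} (hI : I ≠ ⊥) (hJ : J ≠ ⊥) :
    codim (I * J) = codim I + codim J := by
  have hIJ : I * J ≠ 0 := mul_ne_zero hI hJ
  obtain ⟨a, ha⟩ := IsDedekindDomain.exists_sup_span_eq (Ideal.mul_le_left : I * J ≤ I) hIJ
  have haI : Ideal.span {a} ≤ I := ha ▸ le_sup_right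
  obtain ⟨K, hK⟩ := Ideal.dvd_iff_le.mpr haI
  have hJK : J ⊔ K = ⊤ := by
    have h : I * (J ⊔ K) = I * ⊤ := by
      rw [Ideal.mul_sup, ← hK, ha, Ideal.mul_top]
    exact mul_left_cancel₀ hI h
  refine codim_eq_add hIJ a (by rw [sup_comm, ha]) fun r => ⟨fun hr => ?_, fun hr => ?_⟩
  · have h1 : I * (K * Ideal.span {r}) ≤ I * J := by
      rw [← mul_assoc, ← hK, Ideal.span_singleton_mul_span_singleton, mul_comm a,
        Ideal.span_singleton_le_iff_mem]
      exact hr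
    have h2 : K * Ideal.span {r} ≤ J := by
      rw [← Ideal.dvd_iff_le] at h1 ⊢
      exact (mul_dvd_mul_iff_left hI).mp h1
    have h3 : (J ⊔ K) * Ideal.span {r} ≤ J := by
      rw [Ideal.sup_mul]
      exact sup_le Ideal.mul_le_left h2
    rw [hJK, Ideal.top_mul, Ideal.span_singleton_le_iff_mem] at h3
    exact h3
  · rw [mul_comm r]
    exact Ideal.mul_mem_mul (haI (Ideal.mem_span_singleton_self a)) hr

end Codimension

end WeierstrassCurve.Affine.CoordinateRing

namespace WeierstrassCurve.Affine.CoordinateRing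

open Polynomial
open scoped Polynomial.Bivariate nonZeroDivisors

/-! ### Counting ideals of given codimension -/

section IdealCount

variable {F : Type*} [Field F] {W : Affine F}

lemma exists_eq_algebraMap_of_deg_eq_zero {f : W.CoordinateRing} (hf : deg f = 0) :
    ∃ c : F, f = algebraMap F W.CoordinateRing c := by
  obtain ⟨p, q, rfl⟩ := exists_smul_basis_eq f
  obtain ⟨hp, hq⟩ := (deg_basis_le_iff p q 0).mp hf.le
  rw [mem_degreeLT] at hp hq
  have hq0 : q = 0 := by
    rw [← degree_eq_bot]
    exact Nat.WithBot.lt_zero_iff.mp hq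
  have hp0 : p = C (p.coeff 0) := eq_C_of_degree_le_zero (Order.lt_succ_iff.mp hp)
  refine ⟨p.coeff 0, ?_⟩
  rw [hq0, zero_smul, add_zero, hp0, smul, mul_one]
  simp
  rfl

lemma deg_eq_zero_of_isUnit {u : W.CoordinateRing} (hu : IsUnit u) : deg u = 0 :=
  natDegree_eq_zero_of_isUnit (hu.map (Algebra.norm F[X]))

lemma span_eq_span_iff {f g : W.CoordinateRing} :
    Ideal.span {f} = Ideal.span {g} ↔ ∃ c : Fˣ, g = (c : F) • f := by
  rw [Ideal.span_singleton_eq_span_singleton]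
  constructor
  · rintro ⟨u, rfl⟩
    obtain ⟨c, hc⟩ := exists_eq_algebraMap_of_deg_eq_zero (deg_eq_zero_of_isUnit u.isUnit)
    have hc0 : c ≠ 0 := by
      rintro rfl
      rw [map_zero] at hc
      exact u.ne_zero hc
    exact ⟨Units.mk0 c hc0, by rw [hc, Units.val_mk0, Algebra.smul_def, mul_comm]⟩
  · rintro ⟨c, rfl⟩
    rw [Algebra.smul_def, mul_comm]
    exact ⟨Units.map (algebraMap F W.CoordinateRing) c, rfl⟩

/-- The two point ideals have the same class, and the map from points to the class group is
injective. -/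
lemma eq_of_span_mul_pointIdeal_eq {P Q : W.Point} {f g : W.CoordinateRing} (hf : f ≠ 0)
    (hg : g ≠ 0) (h : Ideal.span {f} * pointIdeal P = Ideal.span {g} * pointIdeal Q) : P = Q := by
  classical
  let u : W.Point → (FractionalIdeal W.CoordinateRing⁰ W.FunctionField)ˣ
    | .zero => 1
    | .some _ _ h => XYIdeal' h
  have hu : ∀ P, (u P : FractionalIdeal W.CoordinateRing⁰ W.FunctionField) = pointIdeal P := by
    rintro (_ | ⟨x, y, h⟩)
    · simp [u, pointIdeal]
    · exact XYIdeal'_eq h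
  have hclass : ∀ P, Point.toClass P = Additive.ofMul (ClassGroup.mk W.FunctionField (u P)) := by
    rintro (_ | ⟨x, y, h⟩)
    · exact (map_one (ClassGroup.mk W.FunctionField)).symm
    · rfl
  apply Point.toClass_injective
  rw [hclass, hclass]
  exact congrArg _ ((ClassGroup.mk_eq_mk_of_coe_ideal (hu P) (hu Q)).mpr ⟨f, g, hf, hg, h⟩)

variable (W) in
/-- The nonzero ideals of given codimension. -/
abbrev IdealOfCodim (d : ℕ) : Type _ :=
  {I : Ideal W.CoordinateRing // I ≠ ⊥ ∧ codim I = d}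

/-- The functions in an ideal with given pole order. -/
abbrev FunctionOfDeg (I : Ideal W.CoordinateRing) (m : ℕ) : Type _ :=
  {f : W.CoordinateRing // f ∈ I ∧ f ≠ 0 ∧ deg f = m}

variable (W) in
/-- A nonzero ideal of given codimension with a principal multiple by the ideal of a point. -/
abbrev PrincipalMultiple (d : ℕ) : Type _ :=
  {t : Ideal W.CoordinateRing × W.Point × W.CoordinateRing //
    (t.1 ≠ ⊥ ∧ codim t.1 = d) ∧ t.2.2 ≠ 0 ∧ t.1 * pointIdeal t.2.1 = Ideal.span {t.2.2}}

variable (W) in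
-- Each ideal determines its point uniquely, and the generator up to a nonzero constant.
lemma card_principalMultiple_eq_mul [W.IsElliptic] (d : ℕ) :
    Nat.card (PrincipalMultiple W d) = Nat.card (IdealOfCodim W d) * Nat.card Fˣ := by
  choose P f hf hPf using fun I : IdealOfCodim W d => exists_mul_pointIdeal_eq_span I.2.1
  have hc : ∀ (c : Fˣ) (g : W.CoordinateRing), Ideal.span {(c : F) • g} = Ideal.span {g} :=
    fun c g => by
      rw [Algebra.smul_def]
      exact Ideal.span_singleton_mul_left_unit
        (c.isUnit.map (algebraMap F W.CoordinateRing)) g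
  let φ : IdealOfCodim W d × Fˣ → PrincipalMultiple W d := fun Ic =>
    ⟨(Ic.1.1, P Ic.1, (Ic.2 : F) • f Ic.1), Ic.1.2, smul_ne_zero Ic.2.ne_zero (hf _),
      by rw [hPf, hc]⟩
  have hφ : Function.Bijective φ := by
    constructor
    · rintro ⟨I, c⟩ ⟨J, e⟩ h
      obtain ⟨h1, h2⟩ := Prod.ext_iff.mp (Subtype.ext_iff.mp h)
      obtain rfl : I = J := Subtype.ext h1
      have h3 := smul_left_injective F (hf I) (Prod.ext_iff.mp h2).2
      exact Prod.ext rfl (Units.ext h3)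
    · rintro ⟨⟨I, Q, g⟩, hI, hg, hQ⟩
      have hmul : Ideal.span {f ⟨I, hI⟩} * pointIdeal Q =
          Ideal.span {g} * pointIdeal (P ⟨I, hI⟩) := by
        rw [← hPf, ← hQ, mul_right_comm]
      have hQP : Q = P ⟨I, hI⟩ := eq_of_span_mul_pointIdeal_eq (hf _) hg hmul
      simp only [hQP] at hQ
      obtain ⟨c, hc⟩ := span_eq_span_iff.mp ((hPf ⟨I, hI⟩).symm.trans hQ)
      exact ⟨(⟨I, hI⟩, c), Subtype.ext (Prod.ext rfl (Prod.ext hQP.symm hc.symm))⟩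
  rw [← Nat.card_congr (Equiv.ofBijective φ hφ), Nat.card_prod]

variable (W) in
-- The ideal is recovered from the point and the function by dividing `(f)` by the point ideal.
lemma nonempty_principalMultiple_equiv [W.IsElliptic] (d : ℕ) :
    Nonempty (PrincipalMultiple W d ≃
      Σ P : W.Point, FunctionOfDeg (pointIdeal P) (d + codim (pointIdeal P))) := by
  let φ : PrincipalMultiple W d →
      Σ P : W.Point, FunctionOfDeg (pointIdeal P) (d + codim (pointIdeal P)) := fun t =>
    ⟨t.1.2.1, t.1.2.2, by
      refine ⟨?_, t.2.2.1, ?_⟩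
      · rw [← Ideal.span_singleton_le_iff_mem, ← t.2.2.2]
        exact Ideal.mul_le_right
      · rw [← codim_span t.2.2.1, ← t.2.2.2, codim_mul t.2.1.1 (pointIdeal_ne_bot _), t.2.1.2]⟩
  refine ⟨Equiv.ofBijective φ ⟨?_, ?_⟩⟩
  · rintro ⟨⟨I, P, f⟩, hI, hf, h⟩ ⟨⟨J, Q, g⟩, hJ, hg, h'⟩ heq
    simp only [φ, Sigma.mk.injEq] at heq
    obtain ⟨rfl, heq⟩ := heq
    obtain rfl : f = g := congrArg Subtype.val (eq_of_heq heq)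
    obtain rfl : I = J := mul_right_cancel₀ (pointIdeal_ne_bot P) (h.trans h'.symm)
    rfl
  · rintro ⟨P, f, hfP, hf, hdeg⟩
    obtain ⟨I, hI⟩ := Ideal.dvd_span_singleton.mpr hfP
    rw [mul_comm] at hI
    have hIbot : I ≠ ⊥ := by
      rintro rfl
      rw [Ideal.bot_mul, Ideal.span_singleton_eq_bot] at hI
      exact hf hI
    refine ⟨⟨(I, P, f), ⟨hIbot, ?_⟩, hf, hI.symm⟩, rfl⟩
    have := congrArg codim hI
    rw [codim_span hf, codim_mul hIbot (pointIdeal_ne_bot P)] at this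
    simp only
    omega

lemma finite_functionOfDeg [Finite F] (I : Ideal W.CoordinateRing) (m : ℕ) :
    Finite (FunctionOfDeg I m) := by
  have : Finite (degLE W m) := Module.finite_of_finite F
  let φ : FunctionOfDeg I m → degLE W m := fun f => ⟨f.1, mem_degLE.mpr f.2.2.2.le⟩
  exact Finite.of_injective φ fun f g h => Subtype.ext (congrArg (fun a => a.1) h)

lemma card_functionOfDeg_add [Finite F] (I : Ideal W.CoordinateRing) {m : ℕ} (hm : 1 ≤ m) :
    Nat.card (FunctionOfDeg I m) +
      Nat.card {f : W.CoordinateRing // f ∈ I.restrictScalars F ⊓ degLE W (m - 1)} =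
      Nat.card {f : W.CoordinateRing // f ∈ I.restrictScalars F ⊓ degLE W m} := by
  have := finite_functionOfDeg I m
  have : ∀ n, Finite {f : W.CoordinateRing // f ∈ I.restrictScalars F ⊓ degLE W n} := fun n =>
    have : Finite (degLE W n) := Module.finite_of_finite F
    Finite.of_injective (fun f => (⟨f.1, f.2.2⟩ : degLE W n)) fun f g h =>
      Subtype.ext (congrArg (fun a => a.1) h)
  rw [← Nat.card_sum]
  let φ : FunctionOfDeg I m ⊕ {f : W.CoordinateRing // f ∈ I.restrictScalars F ⊓ degLE W (m - 1)} →
      {f : W.CoordinateRing // f ∈ I.restrictScalars F ⊓ degLE W m} :=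
    Sum.elim (fun f => ⟨f.1, f.2.1, mem_degLE.mpr f.2.2.2.le⟩)
      (fun f => ⟨f.1, f.2.1, mem_degLE.mpr ((mem_degLE.mp f.2.2).trans (Nat.sub_le _ _))⟩)
  refine Nat.card_congr (Equiv.ofBijective φ ⟨?_, ?_⟩)
  · rintro (⟨f, hfI, hf, hd⟩ | ⟨f, hfI, hd⟩) (⟨g, hgI, hg, hd'⟩ | ⟨g, hgI, hd'⟩) h
    all_goals
      obtain rfl : f = g := congrArg (fun a => a.1) h
    · rfl
    · have := mem_degLE.mp hd'
      omega
    · have := mem_degLE.mp hd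
      omega
    · rfl
  · rintro ⟨f, hfI, hd⟩
    by_cases h : deg f ≤ m - 1
    · exact ⟨.inr ⟨f, hfI, mem_degLE.mpr h⟩, rfl⟩
    · refine ⟨.inl ⟨f, hfI, ?_, ?_⟩, rfl⟩
      · rintro rfl
        rw [deg_zero] at h
        omega
      · have := mem_degLE.mp hd
        omega

/-- Vanishing at a point is one linear condition, nontrivial because of the constant function 1. -/
lemma finrank_inf_degLE {x y : F} (h : W.Equation x y) {m : ℕ} (hm : 1 ≤ m) :
    Module.finrank F ↥((XYIdeal W x (C y)).restrictScalars F ⊓ degLE W m) = m - 1 := by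
  set I := XYIdeal W x (C y) with hI
  have hfin := finite_quotient (F := F) (XYIdeal_ne_bot (W := W) x (C y))
  let ψ : degLE W m →ₗ[F] (W.CoordinateRing ⧸ I) :=
    (Ideal.Quotient.mkₐ F I).toLinearMap.comp (degLE W m).subtype
  have h1 := LinearMap.finrank_range_add_finrank_ker ψ
  have hcodim : codim I = 1 := codim_XYIdeal h
  have hrange : Module.finrank F (LinearMap.range ψ) = 1 := by
    refine le_antisymm ((Submodule.finrank_le _).trans hcodim.le) ?_
    rw [Nat.one_le_iff_ne_zero]
    intro h0
    rw [Submodule.finrank_eq_zero, LinearMap.range_eq_bot] at h0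
    have h2 : ψ ⟨1, mem_degLE.mpr (deg_one.trans_le (Nat.zero_le _))⟩ = 0 := by
      rw [h0, LinearMap.zero_apply]
    have h3 : (1 : W.CoordinateRing) ∈ I := Ideal.Quotient.eq_zero_iff_mem.mp h2
    rw [← Ideal.eq_top_iff_one] at h3
    rw [h3, codim_top] at hcodim
    omega
  have hker : Module.finrank F ↥(I.restrictScalars F ⊓ degLE W m) =
      Module.finrank F (LinearMap.ker ψ) := by
    refine LinearEquiv.finrank_eq (LinearEquiv.ofBijective
      ({ toFun := fun f => ⟨⟨f.1, f.2.2⟩, Ideal.Quotient.eq_zero_iff_mem.mpr f.2.1⟩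
         map_add' := fun _ _ => rfl
         map_smul' := fun _ _ => rfl } :
        ↥(I.restrictScalars F ⊓ degLE W m) →ₗ[F] LinearMap.ker ψ) ⟨?_, ?_⟩)
    · intro f g hfg
      exact Subtype.ext (congrArg (fun a => a.1.1) hfg)
    · rintro ⟨⟨f, hf⟩, hfψ⟩
      exact ⟨⟨f, Ideal.Quotient.eq_zero_iff_mem.mp hfψ, hf⟩, rfl⟩
  rw [hrange, finrank_degLE hm] at h1
  omega

lemma card_functionOfDeg_XYIdeal [Finite F] {x y : F} (h : W.Equation x y) {d : ℕ} (hd : 1 ≤ d) :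
    Nat.card (FunctionOfDeg (XYIdeal W x (C y)) (d + 1)) + Nat.card F ^ (d - 1) =
      Nat.card F ^ d := by
  have key := card_functionOfDeg_add (XYIdeal W x (C y)) (Nat.le_add_left 1 d)
  have : ∀ m, 1 ≤ m → Nat.card {f : W.CoordinateRing //
      f ∈ (XYIdeal W x (C y)).restrictScalars F ⊓ degLE W m} = Nat.card F ^ (m - 1) := by
    intro m hm
    have hfin : Module.Finite F ↥((XYIdeal W x (C y)).restrictScalars F ⊓ degLE W m) :=
      Submodule.finiteDimensional_of_le inf_le_right
    rw [← finrank_inf_degLE h hm]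
    exact Module.natCard_eq_pow_finrank (K := F)
  rwa [this _ (by omega), this _ (by omega)] at key

lemma card_functionOfDeg_top [Finite F] {d : ℕ} (hd : 2 ≤ d) :
    Nat.card (FunctionOfDeg (⊤ : Ideal W.CoordinateRing) d) + Nat.card F ^ (d - 1) =
      Nat.card F ^ d := by
  have key := card_functionOfDeg_add (⊤ : Ideal W.CoordinateRing) (show 1 ≤ d by omega)
  have : ∀ m, 1 ≤ m → Nat.card {f : W.CoordinateRing //
      f ∈ (⊤ : Ideal W.CoordinateRing).restrictScalars F ⊓ degLE W m} = Nat.card F ^ m := by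
    intro m hm
    rw [Submodule.restrictScalars_top, top_inf_eq]
    have h := Module.natCard_eq_pow_finrank (K := F) (V := degLE W m)
    rw [finrank_degLE hm] at h
    exact h
  rwa [this _ (by omega), this _ (by omega)] at key

lemma card_functionOfDeg_top_one :
    Nat.card (FunctionOfDeg (⊤ : Ideal W.CoordinateRing) 1) = 0 := by
  have : IsEmpty (FunctionOfDeg (⊤ : Ideal W.CoordinateRing) 1) :=
    ⟨fun f => natDegree_norm_ne_one f.1 f.2.2.2⟩
  exact Nat.card_of_isEmpty

/-- The point at infinity is kept apart: for `d = 1` it contributes nothing, because of the gap. -/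
lemma sum_card_functionOfDeg [Finite F] [Fintype W.Point] {d : ℕ} (hd : 1 ≤ d) :
    ∑ P : W.Point, Nat.card (FunctionOfDeg (pointIdeal P) (d + codim (pointIdeal P))) =
      Nat.card (FunctionOfDeg (⊤ : Ideal W.CoordinateRing) d) +
        (Nat.card W.Point - 1) * (Nat.card F ^ d - Nat.card F ^ (d - 1)) := by
  classical
  rw [Fintype.sum_eq_add_sum_compl Point.zero]
  congr 1
  · rw [show pointIdeal (Point.zero : W.Point) = ⊤ from rfl, codim_top, add_zero]
  · rw [Finset.sum_const_nat (m := Nat.card F ^ d - Nat.card F ^ (d - 1)), Finset.card_compl,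
      Finset.card_singleton, Nat.card_eq_fintype_card (α := W.Point)]
    rintro (_ | ⟨x, y, h⟩) hP
    · simp at hP
    · rw [show pointIdeal (Point.some x y h) = XYIdeal W x (C y) from rfl, codim_XYIdeal h.1]
      have := card_functionOfDeg_XYIdeal h.1 hd
      omega

lemma finite_point [W.IsElliptic] [Finite F] : Finite W.Point := by
  have : Finite {xy : F × F // W.Equation xy.1 xy.2} := inferInstance
  have : Finite (WithZero {xy : F × F // W.Equation xy.1 xy.2}) :=
    inferInstanceAs (Finite (Option _))
  exact Finite.of_equiv _ (pointEquiv W).symm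

lemma card_idealOfCodim_mul [W.IsElliptic] [Finite F] {d : ℕ} (hd : 1 ≤ d) :
    Nat.card (IdealOfCodim W d) * (Nat.card F - 1) =
      Nat.card (FunctionOfDeg (⊤ : Ideal W.CoordinateRing) d) +
        (Nat.card W.Point - 1) * (Nat.card F ^ d - Nat.card F ^ (d - 1)) := by
  have := finite_point (W := W)
  have := Fintype.ofFinite W.Point
  have : ∀ P : W.Point, Finite (FunctionOfDeg (pointIdeal P) (d + codim (pointIdeal P))) :=
    fun P => finite_functionOfDeg _ _
  rw [← Nat.card_units F, ← card_principalMultiple_eq_mul,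
    Nat.card_congr (nonempty_principalMultiple_equiv W d).some, Nat.card_sigma,
    sum_card_functionOfDeg hd]

/-- The number of ideals of codimension `1`. -/
theorem card_idealOfCodim_one [W.IsElliptic] [Finite F] :
    Nat.card (IdealOfCodim W 1) = Nat.card W.Point - 1 := by
  have h := card_idealOfCodim_mul (W := W) le_rfl
  rw [card_functionOfDeg_top_one, zero_add, pow_one, Nat.sub_self, pow_zero] at h
  exact Nat.eq_of_mul_eq_mul_right (Nat.sub_pos_of_lt Finite.one_lt_card) h

/-- The number of ideals of codimension at least `2`. -/
theorem card_idealOfCodim [W.IsElliptic] [Finite F] {d : ℕ} (hd : 2 ≤ d) :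
    Nat.card (IdealOfCodim W d) = Nat.card W.Point * Nat.card F ^ (d - 1) := by
  have := finite_point (W := W)
  have h := card_idealOfCodim_mul (W := W) (d := d) (by omega)
  have htop := card_functionOfDeg_top (W := W) hd
  have hq : 1 < Nat.card F := Finite.one_lt_card
  have hpow : Nat.card F ^ d = Nat.card F ^ (d - 1) * Nat.card F := by
    rw [← pow_succ]
    congr 1
    omega
  have hpos : 0 < Nat.card W.Point := Nat.card_pos
  refine Nat.eq_of_mul_eq_mul_right (Nat.sub_pos_of_lt hq) (h.trans ?_)
  obtain ⟨N, hN⟩ : ∃ N, Nat.card W.Point = N + 1 := ⟨_, (Nat.sub_add_cancel hpos).symm⟩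
  obtain ⟨k, hk⟩ : ∃ k, Nat.card F = k + 1 := ⟨_, (Nat.sub_add_cancel hq.le).symm⟩
  rw [hpow, hk, mul_add, mul_one] at htop
  rw [hpow, hN, hk, Nat.add_sub_cancel, Nat.add_sub_cancel, mul_add, mul_one, Nat.add_sub_cancel,
    Nat.add_right_cancel htop]
  ring

theorem card_idealOfCodim_zero : Nat.card (IdealOfCodim W 0) = 1 := by
  rw [Nat.card_eq_one_iff_unique]
  refine ⟨⟨fun I J => Subtype.ext ?_⟩, ⟨⟨⊤, top_ne_bot, codim_top⟩⟩⟩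
  rw [(codim_eq_zero I.2.1).mp I.2.2, (codim_eq_zero J.2.1).mp J.2.2]

instance finite_idealOfCodim [W.IsElliptic] [Finite F] (d : ℕ) : Finite (IdealOfCodim W d) := by
  have := finite_point (W := W)
  have : ∀ P : W.Point, Finite (FunctionOfDeg (pointIdeal P) (d + codim (pointIdeal P))) :=
    fun P => finite_functionOfDeg _ _
  have : Finite (PrincipalMultiple W d) :=
    .of_equiv _ (nonempty_principalMultiple_equiv W d).some.symm
  refine Finite.of_surjective (fun t : PrincipalMultiple W d => (⟨t.1.1, t.2.1⟩ : IdealOfCodim W d))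
    fun I => ?_
  obtain ⟨P, f, hf, h⟩ := exists_mul_pointIdeal_eq_span I.2.1
  exact ⟨⟨(I.1, P, f), I.2, hf, h⟩, rfl⟩

end IdealCount

end WeierstrassCurve.Affine.CoordinateRing

namespace WeierstrassCurve.Affine.CoordinateRing

open Polynomial UniqueFactorizationMonoid
open scoped Polynomial.Bivariate nonZeroDivisors

/-! ### Prime factorization and the Euler product -/

section CodimPos

variable {F : Type*} [Field F] {W : Affine F}

lemma codim_pos {M : Ideal W.CoordinateRing} (hM : M ≠ ⊥) (hprime : M.IsPrime) : 0 < codim M :=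
  Nat.pos_of_ne_zero fun h => hprime.ne_top ((codim_eq_zero hM).mp h)

end CodimPos

section EulerProduct

variable {F : Type*} [Field F] {W : Affine F} [W.IsElliptic]

lemma codim_multiset_prod (s : Multiset (Ideal W.CoordinateRing)) (hs : ∀ I ∈ s, I ≠ ⊥) :
    codim s.prod = (s.map codim).sum := by
  induction s using Multiset.induction_on with
  | empty => simpa using codim_top
  | cons I s ih =>
    rw [Multiset.prod_cons, Multiset.map_cons, Multiset.sum_cons, codim_mul, ih]
    · exact fun J hJ => hs J (Multiset.mem_cons_of_mem hJ)
    · exact hs I (Multiset.mem_cons_self I s)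
    · exact Multiset.prod_ne_zero fun h => hs 0 (Multiset.mem_cons_of_mem h) rfl

open scoped Classical in
lemma codim_eq_sum_count {I : Ideal W.CoordinateRing} (hI : I ≠ ⊥) :
    codim I = ∑ M ∈ (normalizedFactors I).toFinset, (normalizedFactors I).count M * codim M := by
  conv_lhs => rw [← Ideal.prod_normalizedFactors_eq_self hI]
  rw [codim_multiset_prod, Finset.sum_multiset_map_count]
  · rfl
  · intro J hJ h
    rw [h] at hJ
    exact zero_notMem_normalizedFactors I hJ

lemma codim_pow {M : Ideal W.CoordinateRing} (hM : M ≠ ⊥) (j : ℕ) :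
    codim (M ^ j) = j * codim M := by
  induction j with
  | zero => simpa using codim_top
  | succ j ih => rw [pow_succ, codim_mul (pow_ne_zero j hM) hM, ih, Nat.succ_mul]

open scoped Classical in
lemma pow_dvd_iff_le_count {I M : Ideal W.CoordinateRing} (hI : I ≠ ⊥) (hM : M ≠ ⊥)
    (hprime : M.IsPrime) (j : ℕ) : M ^ j ∣ I ↔ j ≤ (normalizedFactors I).count M := by
  rw [dvd_iff_normalizedFactors_le_normalizedFactors (pow_ne_zero j hM) hI,
    normalizedFactors_pow, normalizedFactors_irreducible
      (Ideal.prime_of_isPrime hM hprime).irreducible, normalize_eq,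
    Multiset.nsmul_singleton, Multiset.le_count_iff_replicate_le]

variable (W) in
/-- The finite set of ideals of given codimension. -/
noncomputable def idealsOfCodim [Finite F] (d : ℕ) : Finset (Ideal W.CoordinateRing) :=
  Set.Finite.toFinset (s := {I : Ideal W.CoordinateRing | I ≠ ⊥ ∧ codim I = d})
    (finite_idealOfCodim d)

lemma mem_idealsOfCodim [Finite F] {d : ℕ} {I : Ideal W.CoordinateRing} :
    I ∈ idealsOfCodim W d ↔ I ≠ ⊥ ∧ codim I = d :=
  Set.Finite.mem_toFinset _

variable (W) in
lemma card_idealsOfCodim [Finite F] (d : ℕ) :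
    (idealsOfCodim W d).card = Nat.card (IdealOfCodim W d) :=
  (Nat.card_eq_card_finite_toFinset _).symm

open scoped Classical in
variable (W) in
/-- The finite set of nonzero prime ideals of bounded codimension. -/
noncomputable def primesOfCodimLE [Finite F] (n : ℕ) : Finset (Ideal W.CoordinateRing) :=
  ((Finset.range (n + 1)).biUnion (idealsOfCodim W)).filter fun M => M.IsPrime

lemma mem_primesOfCodimLE [Finite F] {n : ℕ} {M : Ideal W.CoordinateRing} :
    M ∈ primesOfCodimLE W n ↔ M.IsPrime ∧ M ≠ ⊥ ∧ codim M ≤ n := by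
  simp only [primesOfCodimLE, Finset.mem_filter, Finset.mem_biUnion, Finset.mem_range,
    mem_idealsOfCodim]
  constructor
  · rintro ⟨⟨d, hd, h, rfl⟩, hp⟩
    exact ⟨hp, h, by omega⟩
  · rintro ⟨hp, h, hd⟩
    exact ⟨⟨_, by omega, h, rfl⟩, hp⟩

open scoped Classical in
-- The multiplicity of `M` in `I` is the number of `j ≥ 1` with `M ^ j ∣ I`; it is at most `codim
-- I`, so `j ≤ n` loses nothing.
lemma codim_eq_sum_primes [Finite F] {n : ℕ} {I : Ideal W.CoordinateRing}
    (hI : I ∈ idealsOfCodim W n) :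
    n = ∑ M ∈ primesOfCodimLE W n, ∑ j ∈ Finset.Icc 1 n, if M ^ j ∣ I then codim M else 0 := by
  obtain ⟨hI0, rfl⟩ := mem_idealsOfCodim.mp hI
  have hsub : (normalizedFactors I).toFinset ⊆ primesOfCodimLE W (codim I) := by
    intro M hM
    rw [Multiset.mem_toFinset] at hM
    have hMI : I ≤ M := Ideal.le_of_dvd (dvd_of_mem_normalizedFactors hM)
    exact mem_primesOfCodimLE.mpr ⟨Ideal.isPrime_of_prime (prime_of_normalized_factor M hM),
      ne_bot_of_le_ne_bot hI0 hMI, codim_le_of_le hI0 hMI⟩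
  conv_lhs => rw [codim_eq_sum_count hI0, Finset.sum_subset hsub fun M _ hM => by
    rw [Multiset.mem_toFinset, ← Multiset.count_eq_zero] at hM
    rw [hM, zero_mul]]
  refine Finset.sum_congr rfl fun M hM => ?_
  obtain ⟨hp, hM0, -⟩ := mem_primesOfCodimLE.mp hM
  have hcount : (normalizedFactors I).count M ≤ codim I := by
    have h1 : M ^ (normalizedFactors I).count M ∣ I :=
      (pow_dvd_iff_le_count hI0 hM0 hp _).mpr le_rfl
    have h2 := codim_le_of_le hI0 (Ideal.le_of_dvd h1)
    rw [codim_pow hM0] at h2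
    exact (Nat.le_mul_of_pos_right _ (codim_pos hM0 hp)).trans h2
  simp only [pow_dvd_iff_le_count hI0 hM0 hp]
  rw [← Finset.sum_filter, Finset.sum_const, smul_eq_mul]
  congr 1
  have : (Finset.Icc 1 (codim I)).filter (fun j => j ≤ (normalizedFactors I).count M) =
      Finset.Icc 1 ((normalizedFactors I).count M) := by
    ext j
    simp only [Finset.mem_filter, Finset.mem_Icc]
    omega
  rw [this, Nat.card_Icc, Nat.add_sub_cancel]

open scoped Classical in
lemma card_filter_pow_dvd [Finite F] {n j : ℕ} {M : Ideal W.CoordinateRing} (hM : M ≠ ⊥) :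
    ((idealsOfCodim W n).filter fun I => M ^ j ∣ I).card =
      if j * codim M ≤ n then Nat.card (IdealOfCodim W (n - j * codim M)) else 0 := by
  split_ifs with h
  · rw [← card_idealsOfCodim]
    symm
    refine Finset.card_bij (fun J _ => M ^ j * J) ?_ ?_ ?_
    · intro J hJ
      obtain ⟨hJ0, hJd⟩ := mem_idealsOfCodim.mp hJ
      rw [Finset.mem_filter, mem_idealsOfCodim]
      refine ⟨⟨mul_ne_zero (pow_ne_zero j hM) hJ0, ?_⟩, dvd_mul_right _ _⟩
      rw [codim_mul (pow_ne_zero j hM) hJ0, codim_pow hM, hJd]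
      omega
    · intro J _ K _ h
      exact mul_left_cancel₀ (pow_ne_zero j hM) h
    · intro I hI
      rw [Finset.mem_filter, mem_idealsOfCodim] at hI
      obtain ⟨⟨hI0, hId⟩, J, rfl⟩ := hI
      have hJ0 : J ≠ ⊥ := right_ne_zero_of_mul hI0
      rw [codim_mul (pow_ne_zero j hM) hJ0, codim_pow hM] at hId
      exact ⟨J, mem_idealsOfCodim.mpr ⟨hJ0, by omega⟩, rfl⟩
  · rw [Finset.card_eq_zero, Finset.filter_eq_empty_iff]
    intro I hI hdvd
    obtain ⟨hI0, rfl⟩ := mem_idealsOfCodim.mp hI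
    have h2 := codim_le_of_le hI0 (Ideal.le_of_dvd hdvd)
    rw [codim_pow hM] at h2
    exact h h2

lemma sum_multiples {c n : ℕ} (hc : 0 < c) (A : ℕ → ℕ) :
    ∑ j ∈ Finset.Icc 1 n, (if j * c ≤ n then A (n - j * c) else 0) =
      ∑ k ∈ Finset.Icc 1 n, if c ∣ k then A (n - k) else 0 := by
  rw [← Finset.sum_filter, ← Finset.sum_filter]
  refine Finset.sum_bij (fun j _ => j * c) ?_ ?_ ?_ ?_
  · intro j hj
    simp only [Finset.mem_filter, Finset.mem_Icc] at hj ⊢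
    exact ⟨⟨Nat.mul_pos hj.1.1 hc, hj.2⟩, dvd_mul_left _ _⟩
  · intro i _ j _ h
    exact Nat.eq_of_mul_eq_mul_right hc h
  · intro k hk
    simp only [Finset.mem_filter, Finset.mem_Icc] at hk
    obtain ⟨⟨h1, h2⟩, j, rfl⟩ := hk
    have hj : 0 < j := Nat.pos_of_mul_pos_left h1
    refine ⟨j, ?_, mul_comm _ _⟩
    simp only [Finset.mem_filter, Finset.mem_Icc]
    rw [mul_comm] at h2
    exact ⟨⟨hj, (Nat.le_mul_of_pos_right j hc).trans h2⟩, h2⟩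
  · intro j _
    rfl

open scoped Classical in
/-- The logarithmic derivative of the Euler product of the zeta function, coefficientwise. -/
theorem mul_card_idealOfCodim [Finite F] (n : ℕ) :
    n * Nat.card (IdealOfCodim W n) =
      ∑ k ∈ Finset.Icc 1 n, (∑ M ∈ primesOfCodimLE W n, if codim M ∣ k then codim M else 0) *
        Nat.card (IdealOfCodim W (n - k)) := by
  calc n * Nat.card (IdealOfCodim W n)
      = ∑ I ∈ idealsOfCodim W n, n := by
        rw [Finset.sum_const, card_idealsOfCodim, smul_eq_mul, mul_comm]
    _ = ∑ I ∈ idealsOfCodim W n, ∑ M ∈ primesOfCodimLE W n, ∑ j ∈ Finset.Icc 1 n,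
          if M ^ j ∣ I then codim M else 0 :=
        Finset.sum_congr rfl fun I hI => codim_eq_sum_primes hI
    _ = ∑ M ∈ primesOfCodimLE W n, ∑ j ∈ Finset.Icc 1 n, ∑ I ∈ idealsOfCodim W n,
          if M ^ j ∣ I then codim M else 0 := by
        rw [Finset.sum_comm]
        exact Finset.sum_congr rfl fun M _ => Finset.sum_comm
    _ = ∑ M ∈ primesOfCodimLE W n, codim M * ∑ j ∈ Finset.Icc 1 n,
          if j * codim M ≤ n then Nat.card (IdealOfCodim W (n - j * codim M)) else 0 := by
        refine Finset.sum_congr rfl fun M hM => ?_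
        rw [Finset.mul_sum]
        refine Finset.sum_congr rfl fun j _ => ?_
        rw [← Finset.sum_filter, Finset.sum_const, smul_eq_mul,
          card_filter_pow_dvd (mem_primesOfCodimLE.mp hM).2.1, mul_comm]
    _ = ∑ M ∈ primesOfCodimLE W n, ∑ k ∈ Finset.Icc 1 n,
          (if codim M ∣ k then codim M else 0) * Nat.card (IdealOfCodim W (n - k)) := by
        refine Finset.sum_congr rfl fun M hM => ?_
        obtain ⟨hp, hM0, -⟩ := mem_primesOfCodimLE.mp hM
        rw [sum_multiples (codim_pos hM0 hp) fun m => Nat.card (IdealOfCodim W m), Finset.mul_sum]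
        refine Finset.sum_congr rfl fun k _ => ?_
        split_ifs <;> simp
    _ = _ := by
        rw [Finset.sum_comm]
        exact Finset.sum_congr rfl fun k _ => (Finset.sum_mul _ _ _).symm

end EulerProduct

/-! ### Points over extensions and prime ideals -/

section PointCount

variable {F : Type*} [Field F] {W : Affine F}

lemma ker_ne_bot {L : Type*} [Field L] [Algebra F L] [FiniteDimensional F L]
    (χ : W.CoordinateRing →ₐ[F] L) : RingHom.ker χ ≠ ⊥ := by
  intro h
  have hp := minpoly.ne_zero (Algebra.IsIntegral.isIntegral (R := F) (χ (mk W (C X))))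
  have hmem : mk W (C (minpoly F (χ (mk W (C X))))) ∈ RingHom.ker χ := by
    rw [RingHom.mem_ker, algHom_mk_C, minpoly.aeval]
  rw [h, Ideal.mem_bot, mk_C_eq_algebraMap,
    map_eq_zero_iff _ (FaithfulSMul.algebraMap_injective F[X] W.CoordinateRing)] at hmem
  exact hp hmem

lemma isMaximal_of_isPrime {M : Ideal W.CoordinateRing} (hM : M ≠ ⊥) (hp : M.IsPrime) :
    M.IsMaximal := by
  have := finite_quotient (F := F) hM
  exact Ideal.Quotient.maximal_of_isField M
    (isField_of_isIntegral_of_isField' (R := F) (Field.toIsField F))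

/-- These homomorphisms are the embeddings into `L` of the residue field at `M`, whose degree over
`F` is `codim M`. -/
lemma card_algHom_ker_eq [Finite F] {L : Type*} [Field L] [Finite L] [Algebra F L]
    {M : Ideal W.CoordinateRing} (hM : M ≠ ⊥) (hp : M.IsPrime)
    (hdvd : codim M ∣ Module.finrank F L) :
    Nat.card {χ : W.CoordinateRing →ₐ[F] L // RingHom.ker χ = M} = codim M := by
  have hmax := isMaximal_of_isPrime hM hp
  let : Field (W.CoordinateRing ⧸ M) := Ideal.Quotient.field M
  rw [codim, ← FiniteField.natCard_algHom_of_finrank_dvd (F := F)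
    (K := W.CoordinateRing ⧸ M) (L := L) hdvd]
  refine Nat.card_congr
    { toFun := fun χ => Ideal.Quotient.liftₐ M χ.1 fun a ha => by
        rwa [← RingHom.mem_ker, χ.2]
      invFun := fun ψ => ⟨ψ.comp (Ideal.Quotient.mkₐ F M), ?_⟩
      left_inv := fun χ => Subtype.ext (AlgHom.ext fun a => rfl)
      right_inv := fun ψ => AlgHom.ext fun a => ?_ }
  · ext a
    rw [RingHom.mem_ker, AlgHom.comp_apply, map_eq_zero_iff ψ ψ.injective]
    exact Ideal.Quotient.eq_zero_iff_mem
  · obtain ⟨a, rfl⟩ := Ideal.Quotient.mk_surjective a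
    rfl

open scoped Classical in
lemma card_algHom_eq_sum [W.IsElliptic] [Finite F] {L : Type*} [Field L] [Finite L] [Algebra F L]
    {n : ℕ} (hn : Module.finrank F L ≤ n) :
    Nat.card (W.CoordinateRing →ₐ[F] L) =
      ∑ M ∈ primesOfCodimLE W n, if codim M ∣ Module.finrank F L then codim M else 0 := by
  have hmem : ∀ χ : W.CoordinateRing →ₐ[F] L, RingHom.ker χ ∈
      (primesOfCodimLE W n).filter fun M => codim M ∣ Module.finrank F L := by
    intro χ
    have hbot := ker_ne_bot χ
    have hp : (RingHom.ker χ).IsPrime := RingHom.ker_isPrime χ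
    have hmax := isMaximal_of_isPrime hbot hp
    let : Field (W.CoordinateRing ⧸ RingHom.ker χ) := Ideal.Quotient.field _
    have hdvd : codim (RingHom.ker χ) ∣ Module.finrank F L :=
      FiniteField.nonempty_algHom_iff_finrank_dvd.mp ⟨Ideal.Quotient.liftₐ _ χ fun _ h => h⟩
    rw [Finset.mem_filter, mem_primesOfCodimLE]
    exact ⟨⟨hp, hbot, (Nat.le_of_dvd Module.finrank_pos hdvd).trans hn⟩, hdvd⟩
  let κ : (W.CoordinateRing →ₐ[F] L) →
      ((primesOfCodimLE W n).filter fun M => codim M ∣ Module.finrank F L) :=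
    fun χ => ⟨RingHom.ker χ, hmem χ⟩
  have hcard : ∀ M, Nat.card {χ // κ χ = M} = codim M.1 := fun M => by
    have hM := M.2
    rw [Finset.mem_filter, mem_primesOfCodimLE] at hM
    rw [← card_algHom_ker_eq (L := L) hM.1.2.1 hM.1.1 hM.2]
    exact Nat.card_congr (Equiv.subtypeEquivRight fun χ => Subtype.ext_iff)
  have hfin : ∀ M, Finite {χ // κ χ = M} := fun M =>
    Nat.finite_of_card_ne_zero <| by
      rw [hcard]
      have hM := M.2
      rw [Finset.mem_filter, mem_primesOfCodimLE] at hM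
      exact (codim_pos hM.1.2.1 hM.1.1).ne'
  rw [← Nat.card_congr (Equiv.sigmaFiberEquiv κ), Nat.card_sigma, ← Finset.sum_filter]
  simp only [hcard]
  exact Finset.sum_coe_sort _ codim

/-- The number of rational points in terms of points in affine coordinates. -/
lemma card_point_eq [W.IsElliptic] {L : Type*} [Field L] [Finite L] [Algebra F L] :
    Nat.card (W.baseChange L).Point = Nat.card (W.CoordinateRing →ₐ[F] L) + 1 := by
  have : (W.baseChange L).IsElliptic :=
    inferInstanceAs (WeierstrassCurve.map W (algebraMap F L)).IsElliptic
  have : Finite {P : L × L // (W.baseChange L).Equation P.1 P.2} := inferInstance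
  rw [Nat.card_congr (pointEquiv (W.baseChange L)), Nat.card_congr (algHomEquiv W L)]
  exact Finite.card_option

end PointCount

end WeierstrassCurve.Affine.CoordinateRing

namespace WeierstrassCurve.Affine.CoordinateRing

/-! ### The zeta function -/

section Zeta

/-- The power sums of the roots of `T ^ 2 - a T + q`. -/
def traceSeq {R : Type*} [CommRing R] (a q : R) : ℕ → R
  | 0 => 2
  | 1 => a
  | n + 2 => a * traceSeq a q (n + 1) - q * traceSeq a q n

open PowerSeries in
/-- Recovers the coefficients of the logarithmic derivative of the zeta function. -/
lemma eq_of_logDeriv {R : Type*} [CommRing R] [IsDomain R] {a q : R} {A c : ℕ → R} (hA0 : A 0 = 1) (hA1 : A 1 = q - a)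
    (hA : ∀ n, A (n + 2) = (q + 1 - a) * q ^ (n + 1))
    (hc : ∀ n, n * A n = ∑ k ∈ Finset.Icc 1 n, c k * A (n - k)) {n : ℕ} (hn : 1 ≤ n) :
    c n = q ^ n - traceSeq a q n := by
  let 𝒜 : PowerSeries R := PowerSeries.mk A
  let S : PowerSeries R := PowerSeries.mk (traceSeq a q)
  let G : PowerSeries R := PowerSeries.mk fun k => q ^ k
  let D : PowerSeries R := PowerSeries.mk fun k => if k = 0 then 0 else c k
  let L : PowerSeries R := 1 - C a * X + C q * X * X
  have hAL : 𝒜 * (1 - C q * X) = L := by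
    have h : 𝒜 = L + C q * (𝒜 * X) := by
      ext n
      rcases n with _ | _ | _ | n
      · simp [𝒜, L, hA0]
      · simp [𝒜, L, hA1, coeff_succ_mul_X, hA0, coeff_one, coeff_X]
        ring
      · simp [𝒜, L, hA, hA1, coeff_succ_mul_X, coeff_one]
        ring
      · simp [𝒜, L, hA, coeff_succ_mul_X, coeff_one]
        ring
    linear_combination h
  have hSL : S * L = 1 + 1 - C a * X := by
    have h : S = 1 + 1 - C a * X + C a * (S * X) - C q * (S * X * X) := by
      ext n
      rcases n with _ | _ | n
      · simpa [S, traceSeq] using one_add_one_eq_two.symm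
      · simp [S, traceSeq, coeff_succ_mul_X, coeff_one]
        ring
      · simp [S, traceSeq, coeff_succ_mul_X, coeff_one]
    simp only [L]
    linear_combination h
  have hGU : G * (1 - C q * X) = 1 := by
    have h : G = 1 + C q * (G * X) := by
      ext n
      rcases n with _ | n
      · simp [G]
      · simp [G, coeff_one, pow_succ, mul_comm]
    linear_combination h
  have hder : derivative R 𝒜 * (1 - C q * X) - C q * 𝒜 = 2 * C q * X - C a := by
    have h := congrArg (derivative R) hAL
    simp [L, Derivation.leibniz] at h
    linear_combination h
  have hD : X * derivative R 𝒜 = D * 𝒜 := by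
    ext n
    rw [mul_comm X]
    rcases n with _ | n
    · simp [D]
    · rw [coeff_succ_mul_X, coeff_derivative, coeff_mul,
        Finset.Nat.sum_antidiagonal_eq_sum_range_succ_mk, Finset.sum_range_succ']
      simp only [𝒜, D, coeff_mk, if_true, zero_mul, add_zero, Nat.add_eq_zero_iff, one_ne_zero,
        and_false, if_false]
      have h := hc (n + 1)
      rw [← Finset.Ico_add_one_right_eq_Icc, Finset.sum_Ico_eq_sum_range] at h
      rw [mul_comm]
      push_cast at h
      rw [h]
      refine Finset.sum_congr (by simp) fun k _ => ?_
      rw [add_comm 1 k]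
  have hU : (1 - C q * X : PowerSeries R) ≠ 0 := fun h => by
    rw [h, mul_zero] at hGU
    exact zero_ne_one hGU
  have hA_ne : 𝒜 ≠ 0 := fun h => by
    have := congrArg (coeff 0) h
    simp [𝒜, hA0] at this
  have key : D = G - S + 1 := by
    apply mul_right_cancel₀ hA_ne
    -- After multiplication by `𝒜` and `(1 - qX)²` both sides become polynomials, so no power series
    -- has to be inverted.
    apply mul_right_cancel₀ (pow_ne_zero 2 hU)
    rw [← hD]
    have e1 : X * derivative R 𝒜 * (1 - C q * X) ^ 2 =
        X * (2 * C q * X - C a) * (1 - C q * X) + C q * X * L := by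
      linear_combination X * (1 - C q * X) * hder + C q * X * hAL
    have e2 : (G - S + 1) * 𝒜 * (1 - C q * X) ^ 2 =
        L - (1 + 1 - C a * X) * (1 - C q * X) + (1 - C q * X) * L := by
      linear_combination (G - S + 1) * (1 - C q * X) * hAL + L * hGU - (1 - C q * X) * hSL
    rw [e1, e2]
    simp only [L]
    ring
  have h := congrArg (coeff n) key
  simpa [D, G, S, coeff_one, show n ≠ 0 by omega] using h

variable {F : Type*} [Field F] {W : Affine F} [W.IsElliptic]

/-- The number of points over extensions of finite fields is determined by the number of points
over the base. -/
theorem card_algHom_eq [Finite F] {L : Type*} [Field L] [Finite L] [Algebra F L] {n : ℕ}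
    (hn : Module.finrank F L = n) :
    (Nat.card (W.CoordinateRing →ₐ[F] L) : ℤ) =
      Nat.card F ^ n - traceSeq (Nat.card F + 1 - Nat.card W.Point : ℤ) (Nat.card F) n := by
  classical
  have := finite_point (W := W)
  have hpos : 0 < Nat.card W.Point := Nat.card_pos
  have hn1 : 1 ≤ n := hn ▸ Module.finrank_pos
  -- The cut-off is `k` here and `m` in `mul_card_idealOfCodim`; the sums agree because `codim M ∣
  -- k` bounds `codim M` by `k`.
  let c : ℕ → ℤ := fun k =>
    ∑ M ∈ primesOfCodimLE W k, if codim M ∣ k then (codim M : ℤ) else 0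
  have hc : (Nat.card (W.CoordinateRing →ₐ[F] L) : ℤ) = c n := by
    rw [card_algHom_eq_sum hn.le, hn]
    push_cast
    rfl
  rw [hc]
  refine eq_of_logDeriv (A := fun d => (Nat.card (IdealOfCodim W d) : ℤ)) ?_ ?_ ?_ ?_ hn1
  · simp only [card_idealOfCodim_zero, Nat.cast_one]
  · simp only [card_idealOfCodim_one]
    push_cast [hpos]
    ring
  · intro k
    simp only [card_idealOfCodim (W := W) (show 2 ≤ k + 2 by omega)]
    push_cast
    ring
  · intro m
    have h := mul_card_idealOfCodim (W := W) m
    rw [← Nat.cast_mul, h, Nat.cast_sum]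
    refine Finset.sum_congr rfl fun k hk => ?_
    rw [Nat.cast_mul]
    congr 1
    simp only [c]
    push_cast
    rw [← Finset.sum_filter, ← Finset.sum_filter]
    refine Finset.sum_congr ?_ fun _ _ => rfl
    ext M
    simp only [Finset.mem_filter, mem_primesOfCodimLE]
    constructor
    · rintro ⟨⟨hp, hM, -⟩, hd⟩
      exact ⟨⟨hp, hM, Nat.le_of_dvd (Finset.mem_Icc.mp hk).1 hd⟩, hd⟩
    · rintro ⟨⟨hp, hM, hle⟩, hd⟩
      exact ⟨⟨hp, hM, hle.trans (Finset.mem_Icc.mp hk).2⟩, hd⟩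

end Zeta

end WeierstrassCurve.Affine.CoordinateRing

namespace WeierstrassCurve.Affine.CoordinateRing

/-! ### Growth of the sequence of traces -/

section TraceSeq

lemma traceSeq_add_mul {R : Type*} [CommRing R] (α β : R) (n : ℕ) :
    traceSeq (α + β) (α * β) n = α ^ n + β ^ n := by
  induction n using Nat.twoStepInduction with
  | zero => simp only [traceSeq, pow_zero]; norm_num
  | one => simp only [traceSeq, pow_one]
  | more n h₀ h₁ => rw [traceSeq, h₀, h₁]; ring

lemma map_traceSeq {R S : Type*} [CommRing R] [CommRing S] (f : R →+* S) (a q : R) (n : ℕ) :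
    f (traceSeq a q n) = traceSeq (f a) (f q) n := by
  induction n using Nat.twoStepInduction with
  | zero => simp only [traceSeq, map_ofNat]
  | one => simp only [traceSeq]
  | more n h₀ h₁ => simp only [traceSeq, map_sub, map_mul, h₀, h₁]

lemma traceSeq_two_mul_sqrt_mul_cos {q : ℝ} (hq : 0 ≤ q) (θ : ℝ) (n : ℕ) :
    traceSeq (2 * √q * Real.cos θ) q n = √q ^ n * (2 * Real.cos (n * θ)) := by
  induction n using Nat.twoStepInduction with
  | zero => simp [traceSeq]
  | one => simp [traceSeq]; ring
  | more n h₀ h₁ =>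
    have e : Real.cos ((n + 2 : ℕ) * θ) =
        2 * Real.cos θ * Real.cos ((n + 1 : ℕ) * θ) - Real.cos (n * θ) := by
      have h := Real.cos_add_cos ((n + 2 : ℕ) * θ) (n * θ)
      rw [show ((n + 2 : ℕ) * θ + n * θ) / 2 = (n + 1 : ℕ) * θ by push_cast; ring,
        show ((n + 2 : ℕ) * θ - n * θ) / 2 = θ by push_cast; ring] at h
      linarith
    have hs := Real.sq_sqrt hq
    rw [traceSeq, h₀, h₁, e]
    linear_combination 2 * Real.cos (n * θ) * √q ^ n * hs

/-- If `a² > 4q`, the roots `α, β` are real and `α² + β² = a² - 2q > 2q`, so one square exceeds `q`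
and its powers outgrow `C * q ^ n`. At even indices both summands are nonnegative. -/
lemma sq_le_of_eventually_traceSeq_le {a q C : ℝ} (hq : 0 < q)
    (h : ∀ᶠ n in atTop, traceSeq a q (2 * n) ≤ C * q ^ n) : a ^ 2 ≤ 4 * q := by
  by_contra! ha
  have hs := Real.sq_sqrt (sub_nonneg.mpr ha.le)
  set d := √(a ^ 2 - 4 * q)
  let α := (a + d) / 2
  let β := (a - d) / 2
  have hαβ : α * β = q := by simp only [α, β]; linear_combination -hs / 4
  have hsum : α + β = a := by simp only [α, β]; ring
  have hpow (n : ℕ) : traceSeq a q (2 * n) = (α ^ 2) ^ n + (β ^ 2) ^ n := by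
    rw [← pow_mul, ← pow_mul, ← traceSeq_add_mul, hαβ, hsum]
  obtain ⟨γ, hγ, hγn⟩ : ∃ γ : ℝ, q < γ ∧ ∀ n, γ ^ n ≤ traceSeq a q (2 * n) := by
    by_cases hα : q < α ^ 2
    · exact ⟨α ^ 2, hα, fun n => by rw [hpow]; nlinarith [pow_nonneg (sq_nonneg β) n]⟩
    · refine ⟨β ^ 2, ?_, fun n => by rw [hpow]; nlinarith [pow_nonneg (sq_nonneg α) n]⟩
      nlinarith [show α ^ 2 + β ^ 2 = a ^ 2 - 2 * q by rw [← hsum, ← hαβ]; ring]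
  have hlim := tendsto_pow_atTop_atTop_of_one_lt ((one_lt_div hq).mpr hγ)
  obtain ⟨n, hn, hn'⟩ := (h.and (hlim.eventually_gt_atTop C)).exists
  rw [div_pow, lt_div_iff₀ (pow_pos hq n)] at hn'
  linarith [hγn n]

end TraceSeq

end WeierstrassCurve.Affine.CoordinateRing

/-! ### Torsion, Hasse's bound and the Frobenius angle -/

namespace WeierstrassCurve

open Affine.CoordinateRing

variable {F : Type*} [Field F] [Finite F] (E : WeierstrassCurve F)
  (p : ℕ) [Fact p.Prime] [CharP F p]

variable {E p} in
theorem IsOrdinary.exists_dvd_numPoints (hE : E.IsOrdinary p) :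
    ∃ d : ℕ, 0 < d ∧ ∀ (n : ℕ) [NeZero n], d ∣ n → p ∣ E.numPoints p n := by
  classical
  obtain ⟨P, hP0, hP⟩ := hE
  rcases P with _ | ⟨x, y, hxy⟩
  · exact absurd rfl hP0
  -- The torsion point is rational over `K`, hence over each extension of degree divisible by `[K :
  -- F]`, where its order `p` divides the order of the group.
  let K := IntermediateField.adjoin F {x, y}
  have : FiniteDimensional F K :=
    IntermediateField.finiteDimensional_adjoin fun z _ => Algebra.IsIntegral.isIntegral z
  have : Finite K := Module.finite_of_finite F
  refine ⟨Module.finrank F K, Module.finrank_pos, fun n _ hn => ?_⟩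
  let L := FiniteField.Extension F p n
  let φ : L →ₐ[F] AlgebraicClosure F := IsAlgClosed.lift
  have hcard : Nat.card L = Nat.card K ^ (n / Module.finrank F K) := by
    rw [FiniteField.natCard_extension, Module.natCard_eq_pow_finrank (K := F) (V := K), ← pow_mul,
      Nat.mul_div_cancel' hn]
  have hφ (z : AlgebraicClosure F) (hz : z ∈ K) : ∃ w : L, φ w = z := by
    let := φ.toRingHom.toAlgebra
    refine exists_algebraMap_eq_of_pow_card_eq (F := L) ?_
    have hzK : (⟨z, hz⟩ : K) ^ Nat.card L = ⟨z, hz⟩ := by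
      have := Fintype.ofFinite K
      rw [hcard, Nat.card_eq_fintype_card, FiniteField.pow_card_pow]
    exact congrArg Subtype.val hzK
  obtain ⟨x', rfl⟩ := hφ x (IntermediateField.subset_adjoin _ _ (by simp))
  obtain ⟨y', rfl⟩ := hφ y (IntermediateField.subset_adjoin _ _ (by simp))
  have hxy' := (E.toAffine.baseChange_nonsingular φ.injective x' y').mp hxy
  let Q : (E.baseChange L).toAffine.Point := .some x' y' hxy'
  have hQ : Affine.Point.map (W' := E.toAffine) φ Q = .some (φ x') (φ y') hxy :=
    Affine.Point.map_some φ hxy'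
  have hQp : p • Q = 0 := by
    apply Affine.Point.map_injective (W' := E.toAffine) φ
    rw [map_nsmul, map_zero, hQ]
    convert hP
  have hord := addOrderOf_eq_prime hQp (Affine.Point.some_ne_zero hxy')
  have hdvd := addOrderOf_dvd_natCard Q
  rwa [hord] at hdvd

/-- The trace of Frobenius of a curve over a finite field. -/
noncomputable def frobeniusTrace : ℤ := Nat.card F + 1 - Nat.card E.toAffine.Point

variable [E.IsElliptic]

instance {L : Type*} [Field L] [Algebra F L] : (E.baseChange L).IsElliptic :=
  inferInstanceAs (WeierstrassCurve.map E (algebraMap F L)).IsElliptic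

theorem numPoints_eq (n : ℕ) [NeZero n] :
    (E.numPoints p n : ℤ) =
      (Nat.card F : ℤ) ^ n + 1 - traceSeq E.frobeniusTrace (Nat.card F : ℤ) n := by
  rw [numPoints, show Nat.card (E.baseChange (FiniteField.Extension F p n)).toAffine.Point = _ from
    card_point_eq (W := E.toAffine) (L := FiniteField.Extension F p n), Nat.cast_add,
    card_algHom_eq (FiniteField.finrank_extension F p n)]
  simp only [frobeniusTrace]
  push_cast
  ring

theorem abs_sub_numPoints_le (n : ℕ) [NeZero n] (hn : 4 < Nat.card F ^ n) :
    |((Nat.card F : ℤ) ^ (2 * n) + 1 - E.numPoints p (2 * n))| ≤ 3 * Nat.card F ^ n := by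
  let L := FiniteField.Extension F p (2 * n)
  have : CharP L p := charP_of_injective_algebraMap (algebraMap F L).injective p
  obtain ⟨m, -, hm⟩ : ∃ m : ℕ, _ ∧ Nat.card F = p ^ m := by
    have := Fintype.ofFinite F
    obtain ⟨m, hm⟩ := FiniteField.card F p
    exact ⟨m, hm.1, by rw [Nat.card_eq_fintype_card, hm.2]⟩
  have hL : Nat.card L = (p ^ (m * n)) ^ 2 := by
    rw [FiniteField.natCard_extension, hm, ← pow_mul, ← pow_mul]
    ring_nf
  rw [hm, ← pow_mul] at hn
  have h := abs_card_algHom_sub_le (W := (E.baseChange L).toAffine) hL hn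
  have hc := card_point_eq (W := (E.baseChange L).toAffine) (L := L)
  have hid : ((E.baseChange L).toAffine.baseChange L) = E.baseChange L :=
    (E.baseChange L).map_id
  rw [hid] at hc
  rw [numPoints, hc, hm, ← abs_neg]
  rw [hL] at h
  convert h using 2
  · push_cast
    rw [← pow_mul, ← pow_mul]
    ring_nf
  · push_cast
    rw [← pow_mul]

theorem frobeniusTrace_sq_le : (E.frobeniusTrace : ℝ) ^ 2 ≤ 4 * Nat.card F := by
  obtain ⟨p, hp⟩ := CharP.exists F
  have : Fact p.Prime := ⟨CharP.char_is_prime F p⟩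
  have hq : 1 < Nat.card F := Finite.one_lt_card
  refine sq_le_of_eventually_traceSeq_le (C := 3) (by exact_mod_cast hq.pos) ?_
  filter_upwards [(tendsto_pow_atTop_atTop_of_one_lt hq).eventually_gt_atTop 4,
    eventually_ne_atTop 0] with n hn hn0
  have : NeZero n := ⟨hn0⟩
  have h := (abs_le.mp (E.abs_sub_numPoints_le p n hn)).2
  rw [numPoints_eq] at h
  have h' : traceSeq E.frobeniusTrace (Nat.card F : ℤ) (2 * n) ≤ 3 * Nat.card F ^ n := by linarith
  have e := map_traceSeq (Int.castRingHom ℝ) E.frobeniusTrace (Nat.card F : ℤ) (2 * n)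
  simp only [eq_intCast, Int.cast_natCast] at e
  rw [← e]
  exact_mod_cast h'

/-- The argument of the eigenvalues of Frobenius. -/
noncomputable def frobeniusAngle : ℝ :=
  Real.arccos (E.frobeniusTrace / (2 * √(Nat.card F)))

theorem two_mul_sqrt_mul_cos_frobeniusAngle :
    2 * √(Nat.card F) * Real.cos E.frobeniusAngle = E.frobeniusTrace := by
  have hq : (0 : ℝ) < Nat.card F := by exact_mod_cast Nat.card_pos
  have hs : 0 < 2 * √(Nat.card F : ℝ) := by positivity
  have h : |(E.frobeniusTrace : ℝ)| ≤ 2 * √(Nat.card F : ℝ) := by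
    apply abs_le_of_sq_le_sq _ hs.le
    rw [mul_pow, Real.sq_sqrt hq.le]
    linarith [E.frobeniusTrace_sq_le]
  rw [abs_le] at h
  rw [frobeniusAngle, Real.cos_arccos, mul_div_cancel₀ _ hs.ne']
  · rw [le_div_iff₀ hs]; linarith
  · rw [div_le_iff₀ hs]; linarith

theorem traceSeq_frobeniusTrace (n : ℕ) :
    ((traceSeq E.frobeniusTrace (Nat.card F : ℤ) n : ℤ) : ℝ) =
      √(Nat.card F) ^ n * (2 * Real.cos (n * E.frobeniusAngle)) := by
  rw [← traceSeq_two_mul_sqrt_mul_cos (Nat.cast_nonneg _), two_mul_sqrt_mul_cos_frobeniusAngle]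
  simpa using map_traceSeq (Int.castRingHom ℝ) E.frobeniusTrace (Nat.card F : ℤ) n

theorem normalizedTrace_eq (n : ℕ) [NeZero n] :
    E.normalizedTrace p n = 2 * Real.cos (n * E.frobeniusAngle) := by
  have hq : (0 : ℝ) < Nat.card F := by exact_mod_cast Nat.card_pos
  have h : ((E.numPoints p n : ℤ) : ℝ) = _ := congrArg Int.cast (E.numPoints_eq p n)
  push_cast [traceSeq_frobeniusTrace] at h
  rw [normalizedTrace, h, div_eq_iff (by positivity),
    show (n : ℝ) / 2 = 1 / 2 * n by ring, Real.rpow_mul_natCast hq.le, ← Real.sqrt_eq_rpow]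
  ring

variable {E p}

/-- Otherwise some count divisible by `p` equals `q^{2n} + 1 - 2q^n`, which is 1 modulo `p`. -/
theorem IsOrdinary.cos_nat_mul_frobeniusAngle_ne_one (hE : E.IsOrdinary p) {k : ℕ} (hk : k ≠ 0) :
    Real.cos (k * E.frobeniusAngle) ≠ 1 := by
  intro hcos
  obtain ⟨d, hd, hdvd⟩ := hE.exists_dvd_numPoints
  obtain ⟨m, hm⟩ := (Real.cos_eq_one_iff _).mp hcos
  -- The factor `k` makes the cosine 1 and `d` makes `p` divide the count; the index `2 * n` turns
  -- the power of `√q` into the integer `q^n`.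
  let n := k * d
  have hn : n ≠ 0 := mul_ne_zero hk hd.ne'
  have : NeZero (2 * n) := ⟨by omega⟩
  have hcos' : Real.cos ((2 * n : ℕ) * E.frobeniusAngle) = 1 := by
    refine (Real.cos_eq_one_iff _).mpr ⟨2 * d * m, ?_⟩
    push_cast [n]
    linear_combination 2 * d * hm
  have hs : traceSeq E.frobeniusTrace (Nat.card F : ℤ) (2 * n) = 2 * Nat.card F ^ n := by
    have h := E.traceSeq_frobeniusTrace (2 * n)
    rw [hcos', pow_mul, Real.sq_sqrt (Nat.cast_nonneg _)] at h
    have h' : ((traceSeq E.frobeniusTrace (Nat.card F : ℤ) (2 * n) : ℤ) : ℝ) =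
        ((2 * Nat.card F ^ n : ℤ) : ℝ) := by push_cast; linarith
    exact_mod_cast h'
  have hpN : (p : ℤ) ∣ E.numPoints p (2 * n) :=
    Int.natCast_dvd_natCast.mpr (hdvd _ ⟨2 * k, by simp only [n]; ring⟩)
  have hpq : (p : ℤ) ∣ Nat.card F :=
    Int.natCast_dvd_natCast.mpr ((CharP.cast_eq_zero_iff F p _).mp (by
      have := Fintype.ofFinite F
      rw [Nat.card_eq_fintype_card, Nat.cast_card_eq_zero]))
  rw [numPoints_eq, hs] at hpN
  have hone : (p : ℤ) ∣ 1 := by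
    rw [show (1 : ℤ) = (Nat.card F ^ (2 * n) + 1 - 2 * Nat.card F ^ n) -
      (Nat.card F ^ (2 * n) - 2 * Nat.card F ^ n) by ring]
    exact dvd_sub hpN (dvd_sub (dvd_pow hpq (by omega)) (dvd_mul_of_dvd_right (dvd_pow hpq hn) _))
  exact (Nat.Prime.one_lt Fact.out).ne' (Nat.eq_one_of_dvd_one (by exact_mod_cast hone))

end WeierstrassCurve

/-! ### Weyl's equidistribution criterion -/

section Weyl

/-- Equidistribution can be checked on a family of functions with dense span. -/
theorem tendsto_average_of_dense_span {X : Type*} [TopologicalSpace X] [CompactSpace X]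
    [MeasurableSpace X] [BorelSpace X] (x : ℕ → X) (μ : Measure X) [IsProbabilityMeasure μ]
    {S : Set C(X, ℂ)} (hS : (Submodule.span ℂ S).topologicalClosure = ⊤)
    (h : ∀ f ∈ S, Tendsto (fun n : ℕ => (1 / (n : ℂ)) * ∑ i ∈ Finset.range n, f (x i)) atTop
      (𝓝 (∫ z, f z ∂μ))) (f : C(X, ℂ)) :
    Tendsto (fun n : ℕ => (1 / (n : ℂ)) * ∑ i ∈ Finset.range n, f (x i)) atTop
      (𝓝 (∫ z, f z ∂μ)) := by
  have hint (f : C(X, ℂ)) : Integrable f μ :=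
    f.continuous.integrable_of_hasCompactSupport (HasCompactSupport.of_compactSpace f)
  have hlip (n : ℕ) : LipschitzWith 1
      fun f : C(X, ℂ) => (1 / (n : ℂ)) * ∑ i ∈ Finset.range n, f (x i) := by
    refine LipschitzWith.of_dist_le_mul fun f g => ?_
    rw [dist_eq_norm, dist_eq_norm, ← mul_sub, ← Finset.sum_sub_distrib, norm_mul, NNReal.coe_one,
      one_mul]
    calc ‖1 / (n : ℂ)‖ * ‖∑ i ∈ Finset.range n, (f (x i) - g (x i))‖
        ≤ (1 / n) * ∑ i ∈ Finset.range n, ‖f - g‖ := by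
          rw [norm_div, norm_one, Complex.norm_natCast]
          gcongr
          exact norm_sum_le_of_le _ fun i _ => (f - g).norm_coe_le_norm (x i)
      _ ≤ ‖f - g‖ := by
          rcases eq_or_ne n 0 with rfl | hn
          · simp
          · rw [Finset.sum_const, Finset.card_range, nsmul_eq_mul]
            field_simp
            exact le_rfl
  have hcont : Continuous fun f : C(X, ℂ) => ∫ z, f z ∂μ := by
    refine (LipschitzWith.of_dist_le_mul (K := 1) fun f g => ?_).continuous
    rw [dist_eq_norm, dist_eq_norm, ← integral_sub (hint f) (hint g), NNReal.coe_one, one_mul]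
    simpa using norm_integral_le_of_norm_le_const (μ := μ) (C := ‖f - g‖)
      (ae_of_all _ fun z => (f - g).norm_coe_le_norm z)
  -- The averages are equicontinuous in `f`, so convergence to the continuous limit holds on a
  -- closed set.
  have hclosed := (LipschitzWith.uniformEquicontinuous _ 1 hlip).equicontinuous.isClosed_setOfPred_tendsto
    (l := atTop) hcont
  have hspan : (Submodule.span ℂ S : Set C(X, ℂ)) ⊆ {f | Tendsto (fun n : ℕ => (1 / (n : ℂ)) *
      ∑ i ∈ Finset.range n, f (x i)) atTop (𝓝 (∫ z, f z ∂μ))} := by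
    intro f hf
    induction hf using Submodule.span_induction with
    | mem f hf => exact h f hf
    | zero => simp
    | add f g _ _ hf hg =>
      have e := hf.add hg
      simp only [Set.mem_ofPred_eq, ContinuousMap.add_apply]
      rw [integral_add (hint f) (hint g)]
      simpa only [Finset.sum_add_distrib, mul_add] using e
    | smul c f _ hf =>
      have e := hf.const_mul c
      simp only [Set.mem_ofPred_eq, ContinuousMap.smul_apply, smul_eq_mul]
      rw [integral_const_mul]
      simpa only [Finset.mul_sum, mul_left_comm c] using e
  have hf : f ∈ (Submodule.span ℂ S).topologicalClosure := hS ▸ Submodule.mem_top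
  exact closure_minimal hspan hclosed hf

/-- The geometric sums are bounded by `2 / ‖z - 1‖`. -/
theorem tendsto_average_pow_of_norm_eq_one {z : ℂ} (hz : ‖z‖ = 1) (hz1 : z ≠ 1) :
    Tendsto (fun n : ℕ => (1 / (n : ℂ)) * ∑ i ∈ Finset.range n, z ^ (i + 1)) atTop (𝓝 0) := by
  refine squeeze_zero_norm (a := fun n : ℕ => 2 / ‖z - 1‖ * (1 / (n : ℝ))) (fun n => ?_) ?_
  · have e : ∑ i ∈ Finset.range n, z ^ (i + 1) = z * ((z ^ n - 1) / (z - 1)) := by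
      rw [← geom_sum_eq hz1, Finset.mul_sum]
      exact Finset.sum_congr rfl fun i _ => pow_succ' z i
    have h2 : ‖z ^ n - 1‖ ≤ 2 := (norm_sub_le _ _).trans (by rw [norm_pow, hz]; norm_num)
    rw [e, norm_mul, norm_mul, hz, norm_div, norm_div, norm_one, Complex.norm_natCast, one_mul,
      mul_comm]
    gcongr
  · simpa using tendsto_one_div_atTop_nhds_zero_nat.const_mul (2 / ‖z - 1‖)

variable {T : ℝ} [hT : Fact (0 < T)]

theorem integral_fourier_of_ne_zero {n : ℤ} (hn : n ≠ 0) :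
    ∫ x : AddCircle T, fourier n x ∂AddCircle.haarAddCircle = 0 := by
  have h := (orthonormal_iff_ite.mp (orthonormal_fourier (T := T))) 0 n
  rw [ContinuousMap.inner_toLp, if_neg hn.symm] at h
  simpa using h

/-- Weyl's equidistribution theorem. -/
theorem tendsto_average_nsmul {θ : AddCircle T} (hθ : ∀ k : ℤ, k ≠ 0 → fourier k θ ≠ 1)
    (f : C(AddCircle T, ℂ)) :
    Tendsto (fun n : ℕ => (1 / (n : ℂ)) * ∑ i ∈ Finset.range n, f ((i + 1) • θ)) atTop
      (𝓝 (∫ z, f z ∂AddCircle.haarAddCircle)) := by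
  refine tendsto_average_of_dense_span (fun i => (i + 1) • θ) _ span_fourier_closure_eq_top ?_ f
  rintro _ ⟨k, rfl⟩
  have hpow (i : ℕ) : fourier k ((i + 1) • θ) = (fourier k θ) ^ (i + 1) := by
    rw [fourier_apply, fourier_apply, smul_comm, AddCircle.toCircle_nsmul, Circle.coe_pow]
  simp only [hpow]
  rcases eq_or_ne k 0 with rfl | hk
  · simp only [fourier_zero, one_pow, Finset.sum_const, Finset.card_range, nsmul_eq_mul, mul_one,
      integral_const, probReal_univ, one_smul]
    refine tendsto_const_nhds.congr' ?_
    filter_upwards [eventually_ne_atTop 0] with n hn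
    field_simp
  · rw [integral_fourier_of_ne_zero hk]
    refine tendsto_average_pow_of_norm_eq_one ?_ (hθ k hk)
    rw [fourier_apply, Circle.norm_coe]

end Weyl

/-! ### The measure on `[-2, 2]` and the cosine -/

section TraceMeasure

/-- Twice the cosine, as a map to `[-2, 2]`. -/
noncomputable def twoCos (t : ℝ) : Set.Icc (-2 : ℝ) 2 :=
  ⟨2 * Real.cos t, by linarith [Real.neg_one_le_cos t], by linarith [Real.cos_le_one t]⟩

lemma continuous_twoCos : Continuous twoCos :=
  Continuous.subtype_mk (by fun_prop) _

/-- This is the substitution `t = arccos (z / 2)`, which is decreasing with derivative `-1 / √(4 -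
z²)`. -/
theorem integral_traceMeasure (f : Set.Icc (-2 : ℝ) 2 → ℂ) :
    ∫ z, f z ∂traceMeasure = Real.pi⁻¹ • ∫ t in 0..Real.pi, f (twoCos t) := by
  let g : ℝ → ℂ := fun z => f (Set.projIcc (-2) 2 (by norm_num) z)
  have hg (z : Set.Icc (-2 : ℝ) 2) : f z = g z := by simp only [g, Set.projIcc_val]
  rw [traceMeasure, integral_withDensity_eq_integral_toReal_smul (by fun_prop) (by simp)]
  have e (z : ℝ) : (ENNReal.ofReal (1 / Real.pi * (1 / √(4 - z ^ 2)))).toReal =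
      1 / Real.pi * (1 / √(4 - z ^ 2)) :=
    ENNReal.toReal_ofReal (by positivity)
  simp only [hg, e, twoCos]
  rw [integral_subtype_comap measurableSet_Icc
    (fun z : ℝ => (1 / Real.pi * (1 / √(4 - z ^ 2))) • g z), integral_Icc_eq_integral_Ioc,
    ← intervalIntegral.integral_of_le (by norm_num)]
  have hder (z : ℝ) (hz : z ∈ Set.Ioo (min (-2) 2) (max (-2) 2 : ℝ)) :
      HasDerivAt (fun z => Real.arccos (z / 2)) (-(1 / √(4 - z ^ 2))) z := by
    norm_num at hz
    have h := (Real.hasDerivAt_arccos (x := z / 2) (by linarith) (by linarith)).comp z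
      ((hasDerivAt_id z).div_const 2)
    convert! h using 1
    have hs : √(4 - z ^ 2) = 2 * √(1 - (z / 2) ^ 2) := by
      rw [show 4 - z ^ 2 = 2 ^ 2 * (1 - (z / 2) ^ 2) by ring, Real.sqrt_mul (by norm_num),
        Real.sqrt_sq (by norm_num)]
    rw [hs]
    ring
  have h := intervalIntegral.integral_deriv_smul_comp_of_deriv_nonpos (a := -2) (b := 2)
    (f := fun z => Real.arccos (z / 2)) (g := fun t => g (2 * Real.cos t))
    (Continuous.continuousOn (by fun_prop)) hder
    (fun z _ => neg_nonpos.mpr (by positivity))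
  norm_num at h
  rw [intervalIntegral.integral_symm Real.pi 0, ← h, neg_neg,
    ← intervalIntegral.integral_smul]
  refine intervalIntegral.integral_congr fun z hz => ?_
  rw [Set.uIcc_of_le (by norm_num)] at hz
  rw [Real.cos_arccos (by linarith [hz.1]) (by linarith [hz.2]), mul_div_cancel₀ _ two_ne_zero]
  simp [mul_assoc]

instance : IsProbabilityMeasure traceMeasure := by
  have h := integral_traceMeasure fun _ => 1
  have hpi := Real.pi_ne_zero
  simp only [integral_const, intervalIntegral.integral_const, sub_zero, smul_smul,
    inv_mul_cancel₀ hpi, one_smul] at h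
  have h' : traceMeasure.real Set.univ = 1 := by
    simpa using h
  exact ⟨(ENNReal.toReal_eq_one_iff _).mp h'⟩

theorem isEquidistributed_twoCos {θ : ℝ} (hθ : ∀ k : ℕ, k ≠ 0 → Real.cos (k * θ) ≠ 1) :
    IsEquidistributed (fun n : ℕ => twoCos ((n + 1 : ℕ) * θ)) traceMeasure := by
  refine ⟨inferInstance, fun f => ?_⟩
  have : Fact (0 < 2 * Real.pi) := ⟨Real.two_pi_pos⟩
  have hper : Function.Periodic twoCos (2 * Real.pi) := fun t => by simp [twoCos]
  let g : C(AddCircle (2 * Real.pi), ℂ) :=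
    f.comp ⟨hper.lift, continuous_coinduced_dom.mpr continuous_twoCos⟩
  have hg (t : ℝ) : g t = f (twoCos t) := rfl
  -- The real part of this character value is `cos (kθ)`, and evenness of the cosine replaces `k` by
  -- its absolute value.
  have hne (k : ℤ) (hk : k ≠ 0) : fourier k (θ : AddCircle (2 * Real.pi)) ≠ 1 := by
    rw [fourier_coe_apply, show 2 * (Real.pi : ℂ) * Complex.I * k * θ / (2 * Real.pi : ℝ) =
      (k * θ : ℝ) * Complex.I by push_cast; field_simp]
    intro h
    have h := congrArg Complex.re h
    rw [Complex.exp_ofReal_mul_I_re, Complex.one_re] at h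
    refine hθ k.natAbs (Int.natAbs_ne_zero.mpr hk) ?_
    rw [Nat.cast_natAbs, Int.cast_abs, ← h]
    rcases abs_choice (k : ℝ) with hk | hk <;> simp [hk]
  have h := tendsto_average_nsmul hne g
  have hterm (i : ℕ) : g ((i + 1) • (θ : AddCircle (2 * Real.pi))) =
      f (twoCos ((i + 1 : ℕ) * θ)) := by
    rw [← hg, ← nsmul_eq_mul]
    rfl
  have hcont : Continuous fun t => f (twoCos t) := f.continuous.comp continuous_twoCos
  have hint : ∫ z, g z ∂AddCircle.haarAddCircle = ∫ z, f z ∂traceMeasure := by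
    rw [AddCircle.integral_haarAddCircle, ← AddCircle.intervalIntegral_preimage _ (-Real.pi),
      show -Real.pi + 2 * Real.pi = Real.pi by ring, integral_traceMeasure]
    simp only [hg]
    -- Evenness of the cosine folds the circle onto `[0, π]`; the resulting factor 2 turns `1 /
    -- (2π)` into `1 / π`.
    have hneg : ∫ t in -Real.pi..0, f (twoCos t) = ∫ t in 0..Real.pi, f (twoCos t) := by
      rw [← neg_zero, ← intervalIntegral.integral_comp_neg, neg_zero]
      simp [twoCos]
    rw [← intervalIntegral.integral_add_adjacent_intervals (hcont.intervalIntegrable _ 0)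
      (hcont.intervalIntegrable _ _), hneg, ← two_smul ℝ, smul_smul]
    congr 1
    field_simp
  simpa only [hterm, hint] using h

end TraceMeasure

theorem mainTheorem5 {F : Type*} [Field F] [Finite F] (p : ℕ) [Fact p.Prime] [CharP F p]
    (E : WeierstrassCurve F) [E.IsElliptic] (hE : E.IsOrdinary p) :
    ∃ h : ∀ n : ℕ, E.normalizedTrace p (n + 1) ∈ Set.Icc (-2 : ℝ) 2,
      IsEquidistributed (fun n : ℕ => ⟨E.normalizedTrace p (n + 1), h n⟩) traceMeasure := by
  have heq (n : ℕ) : E.normalizedTrace p (n + 1) = twoCos ((n + 1 : ℕ) * E.frobeniusAngle) :=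
    E.normalizedTrace_eq p (n + 1)
  refine ⟨fun n => heq n ▸ Subtype.property _, ?_⟩
  convert! isEquidistributed_twoCos fun k hk => hE.cos_nat_mul_frobeniusAngle_ne_one hk with n
  exact heq n
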